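/- Let $L^2_{\rm per}$ be the space of $2\pi$-periodic, locally square integrable functions $u:\mathbb R\to\mathbb C$, with inner product $(u,v)=\int_0^{2\pi}\overline{u(x)}\,v(x)\,dx$. For $k\in\mathbb Z$ let $e_k(x)=(2\pi)^{-1/2}e^{ikx}$ and $\widehat u_k=(e_k,u)$. Let $H^s_{\rm per}$ ($s\ge 0$) be the space of $u\in L^2_{\rm per}$ with $\|u\|_{H^s_{\rm per}}^2=\sum_{k\in\mathbb Z}(1+|k|^2)^s|\widehat u_k|^2<\infty$, and for $A>0$ let $\mathcal H_A$ be the space of $u\in L^2_{\rm per}$ with $\sum_{k\in\mathbb Z}\cosh(2Ak)\,|\widehat u_k|^2<\infty$. Let $B>0$, let $V\in\mathcal H_B$ be real-valued, let $j\ge 1$ be an integer and let $0<A<B$. Let $\lambda_j$ be the $j$-th lowest eigenvalue, counting multiplicities, of the self-adjoint operator $H=-\Delta+V$ on $L^2_{\rm per}$ with domain $H^2_{\rm per}$ (it exists), and let $\mathcal E_j=\operatorname{Ker}(H-\lambda_j)$. For real $N>0$ let $X_N=\operatorname{Span}(e_k,\ k\in\mathbb Z,\ |k|\le N)$, and consider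 the discrete eigenvalue problem: find $(u_N,\lambda_N)\in X_N\times\mathbb R$ such that $\|u_N\|_{L^2_{\rm per}}=1$ and $$\int_0^{2\pi}\overline{\nabla u_N}\cdot\nabla v_N+\int_0^{2\pi}V\,\overline{u_N}\,v_N=\lambda_N\int_0^{2\pi}\overline{u_N}\,v_N\qquad\text{for all }v_N\in X_N .$$ Then there is a constant $c\in[0,\infty)$, independent of $N$, such that for every real $N>0$ with $2\lfloor N\rfloor+1\ge j$ the following holds: the discrete problem has a $j$-th lowest eigenvalue $\lambda_{j,N}$ counting multiplicities, and every associated normalized eigenvector $u_{j,N}$ satisfies $$d_{H^1_{\rm per}}(u_{j,N},\mathcal E_j)=\inf_{v\in\mathcal E_j}\|u_{j,N}-v\|_{H^1_{\rm per}}\le c\,e^{-AN},\qquad\text{and}\qquad 0\le\lambda_{j,N}-\lambda_j\le c\,e^{-2AN}.$$ -/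

import Mathlib

open MeasureTheory
open scoped Real ComplexConjugate

noncomputable section

namespace Planewave

/-- The period `2π` is positive. -/
instance instTwoPiPos : Fact (0 < 2 * π) := ⟨Real.two_pi_pos⟩

/-- The circle `ℝ / 2πℤ`; its measure `volume` has total mass `2π`. -/
abbrev Circle2Pi : Type := AddCircle (2 * π)

/-- `L²_per(ℝ, ℂ)`, with inner product `(u, v) = ∫₀^{2π} conj (u x) * v x dx`. -/
abbrev L2per : Type := Lp ℂ 2 (volume : Measure Circle2Pi)

/-- The normalized Fourier mode `e_k(x) = (2π)^{-1/2} e^{ikx}` as an element of `L²_per`. -/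
def planeWave (k : ℤ) : L2per :=
  (((√(2 * π))⁻¹ : ℝ) : ℂ) •
    ContinuousMap.toLp (E := ℂ) 2 (volume : Measure Circle2Pi) ℂ (fourier k)

theorem orthonormal_planeWave : Orthonormal ℂ planeWave := by
  rw [orthonormal_iff_ite]
  intro i j
  have key : inner ℂ (planeWave i) (planeWave j)
      = ((2 * π : ℝ) : ℂ)⁻¹ * inner ℂ
        (ContinuousMap.toLp (E := ℂ) 2 (volume : Measure Circle2Pi) ℂ (fourier i))
        (ContinuousMap.toLp (E := ℂ) 2 (volume : Measure Circle2Pi) ℂ (fourier j)) := by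
    unfold planeWave
    rw [inner_smul_left, inner_smul_right, Complex.conj_ofReal, ← mul_assoc,
      ← Complex.ofReal_mul, ← mul_inv, Real.mul_self_sqrt Real.two_pi_pos.le, Complex.ofReal_inv]
  have hhaar := (orthonormal_iff_ite.mp (orthonormal_fourier (T := 2 * π))) i j
  rw [ContinuousMap.inner_toLp, AddCircle.integral_haarAddCircle, Complex.real_smul,
    Complex.ofReal_inv] at hhaar
  rw [key, ContinuousMap.inner_toLp, hhaar]

theorem span_planeWave : ⊤ ≤ (Submodule.span ℂ (Set.range planeWave)).topologicalClosure := by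
  have h := (ContinuousMap.toLp_denseRange ℂ (volume : Measure Circle2Pi) ℂ
    (p := 2) (by simp)).topologicalClosure_map_submodule
      (span_fourier_closure_eq_top (T := 2 * π))
  rw [← h]
  apply Submodule.topologicalClosure_mono
  rw [Submodule.map_span, Submodule.span_le]
  rintro _ ⟨_, ⟨k, rfl⟩, rfl⟩
  have hne : (((√(2 * π))⁻¹ : ℝ) : ℂ) ≠ 0 := by
    have := Real.sqrt_pos.mpr Real.two_pi_pos
    exact_mod_cast (inv_pos.mpr this).ne'
  have hk : planeWave k ∈ Submodule.span ℂ (Set.range planeWave) :=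
    Submodule.subset_span ⟨k, rfl⟩
  have := Submodule.smul_mem _ ((((√(2 * π))⁻¹ : ℝ) : ℂ))⁻¹ hk
  unfold planeWave at this
  rw [inv_smul_smul₀ hne] at this
  exact this

/-- The Fourier modes `e_k`, `k ∈ ℤ`, form a Hilbert basis of `L²_per`. -/
def planeWaveBasis : HilbertBasis ℤ ℂ L2per :=
  HilbertBasis.mk orthonormal_planeWave span_planeWave

/-- The Fourier coefficient `û_k = (e_k, u)`. -/
def coeff (u : L2per) (k : ℤ) : ℂ := inner ℂ (planeWave k) u

theorem planeWaveBasis_repr (u : L2per) (k : ℤ) : planeWaveBasis.repr u k = coeff u k := by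
  rw [HilbertBasis.repr_apply_apply, planeWaveBasis, HilbertBasis.coe_mk, coeff]

theorem coeff_add (u v : L2per) (k : ℤ) : coeff (u + v) k = coeff u k + coeff v k :=
  inner_add_right _ _ _

theorem coeff_smul (c : ℂ) (u : L2per) (k : ℤ) : coeff (c • u) k = c * coeff u k :=
  inner_smul_right _ _ _

/-- The space of all `u ∈ L²_per` with `∑ₖ w(k) |û_k|² < ∞`, for a nonnegative weight `w`. -/
def weightedSpace (w : ℤ → ℝ) (hw : ∀ k, 0 ≤ w k) : Submodule ℂ L2per where
  carrier := {u | Summable fun k : ℤ => w k * ‖coeff u k‖ ^ 2}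
  zero_mem' := by simp [coeff, summable_zero]
  add_mem' := by
    intro u v hu hv
    refine Summable.of_nonneg_of_le (fun k => mul_nonneg (hw k) (by positivity)) (fun k => ?_)
      ((hu.add hv).mul_left 2)
    rw [coeff_add]
    have h1 : ‖coeff u k + coeff v k‖ ^ 2 ≤ 2 * (‖coeff u k‖ ^ 2 + ‖coeff v k‖ ^ 2) := by
      have h2 := norm_add_le (coeff u k) (coeff v k)
      nlinarith [sq_nonneg (‖coeff u k‖ - ‖coeff v k‖), norm_nonneg (coeff u k + coeff v k),
        norm_nonneg (coeff u k), norm_nonneg (coeff v k)]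
    nlinarith [mul_le_mul_of_nonneg_left h1 (hw k)]
  smul_mem' := by
    intro c u hu
    refine (hu.mul_left (‖c‖ ^ 2)).congr (fun k => ?_)
    rw [coeff_smul, norm_mul]
    ring

/-- The periodic Sobolev space `H^s_per(ℝ, ℂ)`, for `s ≥ 0`. -/
def sobolev (s : ℝ) : Submodule ℂ L2per :=
  weightedSpace (fun k => (1 + (k : ℝ) ^ 2) ^ s) (fun _ => by positivity)

/-- The norm of `H^s_per(ℝ, ℂ)`, for elements of that space. -/
def sobolevNorm (s : ℝ) (u : L2per) : ℝ :=
  √(∑' k : ℤ, (1 + (k : ℝ) ^ 2) ^ s * ‖coeff u k‖ ^ 2)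

/-- The space `𝓗_A` of all `u ∈ L²_per` with `∑ₖ cosh(2Ak) |û_k|² < ∞`. -/
def analyticSpace (A : ℝ) : Submodule ℂ L2per :=
  weightedSpace (fun k => Real.cosh (2 * A * k)) (fun _ => (Real.cosh_pos _).le)

theorem mem_sobolev_one {u : L2per} :
    u ∈ sobolev 1 ↔ Summable fun k : ℤ => (1 + (k : ℝ) ^ 2) * ‖coeff u k‖ ^ 2 := by
  change Summable (fun k : ℤ => (1 + (k : ℝ) ^ 2) ^ (1 : ℝ) * ‖coeff u k‖ ^ 2) ↔ _
  simp_rw [Real.rpow_one]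

theorem mem_sobolev_two {u : L2per} :
    u ∈ sobolev 2 ↔ Summable fun k : ℤ => (1 + (k : ℝ) ^ 2) ^ 2 * ‖coeff u k‖ ^ 2 := by
  change Summable (fun k : ℤ => (1 + (k : ℝ) ^ 2) ^ (2 : ℝ) * ‖coeff u k‖ ^ 2) ↔ _
  simp_rw [Real.rpow_two]

theorem sobolev_two_le_one : sobolev 2 ≤ sobolev 1 := by
  intro u hu
  rw [mem_sobolev_two] at hu
  rw [mem_sobolev_one]
  refine Summable.of_nonneg_of_le (fun k => by positivity) (fun k => ?_) hu
  refine mul_le_mul_of_nonneg_right ?_ (by positivity)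
  nlinarith [sq_nonneg (k : ℝ)]

/-- The operator multiplying the `k`-th Fourier coefficient by `m k`, on a domain where the
resulting sequence is square summable. -/
def fourierMultiplier (m : ℤ → ℂ) (D : Submodule ℂ L2per)
    (h : ∀ u ∈ D, Memℓp (fun k => m k * coeff u k) 2) : D →ₗ[ℂ] L2per where
  toFun u := planeWaveBasis.repr.symm ⟨fun k => m k * coeff u k, h u u.2⟩
  map_add' u v := by
    rw [← map_add]
    congr 1
    ext k
    simp only [Submodule.coe_add, coeff_add, mul_add]
    rfl
  map_smul' c u := by
    rw [RingHom.id_apply, ← map_smul]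
    congr 1
    ext k
    simp [coeff_smul, mul_left_comm]

theorem coeff_fourierMultiplier (m : ℤ → ℂ) (D : Submodule ℂ L2per)
    (h : ∀ u ∈ D, Memℓp (fun k => m k * coeff u k) 2) (u : D) (k : ℤ) :
    coeff (fourierMultiplier m D h u) k = m k * coeff u k := by
  rw [← planeWaveBasis_repr, fourierMultiplier, LinearMap.coe_mk, AddHom.coe_mk,
    LinearIsometryEquiv.apply_symm_apply]

theorem memlp_grad (u : L2per) (hu : u ∈ sobolev 1) :
    Memℓp (fun k : ℤ => (Complex.I * k) * coeff u k) 2 := by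
  rw [mem_sobolev_one] at hu
  rw [memℓp_gen_iff (by norm_num)]
  refine Summable.of_nonneg_of_le (fun k => by positivity) (fun k => ?_) hu
  simp only [ENNReal.toReal_ofNat, Real.rpow_two, norm_mul, Complex.norm_I, one_mul,
    Complex.norm_intCast, mul_pow, sq_abs]
  nlinarith [sq_nonneg ‖coeff u k‖]

theorem memlp_laplacian (u : L2per) (hu : u ∈ sobolev 2) :
    Memℓp (fun k : ℤ => (-(k : ℂ) ^ 2) * coeff u k) 2 := by
  rw [mem_sobolev_two] at hu
  rw [memℓp_gen_iff (by norm_num)]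
  refine Summable.of_nonneg_of_le (fun k => by positivity) (fun k => ?_) hu
  simp only [ENNReal.toReal_ofNat, Real.rpow_two, norm_mul, norm_neg, norm_pow,
    Complex.norm_intCast, mul_pow, sq_abs]
  refine mul_le_mul_of_nonneg_right ?_ (by positivity)
  nlinarith [sq_nonneg (k : ℝ)]

/-- The weak derivative `∇ : H¹_per → L²_per`. -/
def grad : sobolev 1 →ₗ[ℂ] L2per :=
  fourierMultiplier (fun k => Complex.I * k) (sobolev 1) memlp_grad

/-- The Laplacian `Δ : H²_per → L²_per`. -/
def laplacian : sobolev 2 →ₗ[ℂ] L2per :=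
  fourierMultiplier (fun k => -(k : ℂ) ^ 2) (sobolev 2) memlp_laplacian

theorem summable_coeff (u : L2per) (hu : u ∈ sobolev 1) : Summable fun k => ‖coeff u k‖ := by
  rw [mem_sobolev_one] at hu
  have h2 : Summable fun k : ℤ => (1 + (k : ℝ) ^ 2)⁻¹ := by
    have h3 : Summable fun k : ℤ => 1 / (k : ℝ) ^ 2 :=
      Real.summable_one_div_int_pow.mpr (by norm_num)
    refine (summable_of_hasFiniteSupport (f := fun k : ℤ => if k = 0 then (1 : ℝ) else 0) ?_
      |>.add h3).of_nonneg_of_le (fun k => by positivity) (fun k => ?_)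
    · exact (Set.finite_singleton (0 : ℤ)).subset (by intro k; simp)
    · by_cases hk : k = 0
      · simp [hk]
      · have : (k : ℝ) ≠ 0 := by exact_mod_cast hk
        simp only [hk, if_false, zero_add, one_div]
        gcongr
        linarith
  refine Summable.of_nonneg_of_le (fun k => norm_nonneg _) (fun k => ?_) (h2.add hu)
  have hp : 0 < 1 + (k : ℝ) ^ 2 := by positivity
  have h5 : (1 + (k : ℝ) ^ 2)⁻¹ * (1 + (k : ℝ) ^ 2) = 1 := inv_mul_cancel₀ hp.ne'
  have h6 : (1 + (k : ℝ) ^ 2)⁻¹ + (1 + (k : ℝ) ^ 2) * ‖coeff u k‖ ^ 2 - 2 * ‖coeff u k‖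
      = (1 + (k : ℝ) ^ 2)⁻¹ * (1 - (1 + (k : ℝ) ^ 2) * ‖coeff u k‖) ^ 2 := by
    field_simp
    ring
  have h7 : 0 ≤ (1 + (k : ℝ) ^ 2)⁻¹ * (1 - (1 + (k : ℝ) ^ 2) * ‖coeff u k‖) ^ 2 := by positivity
  linarith [norm_nonneg (coeff u k)]

/-- Elements of `H¹_per` have a continuous representative. -/
theorem exists_continuous (u : L2per) (hu : u ∈ sobolev 1) :
    ∃ f : C(Circle2Pi, ℂ), u =ᵐ[volume] f := by
  have hs := summable_coeff u hu
  have hsum : Summable fun k : ℤ =>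
      (coeff u k * (((√(2 * π))⁻¹ : ℝ) : ℂ)) • (fourier k : C(Circle2Pi, ℂ)) := by
    refine Summable.of_norm ?_
    simp_rw [norm_smul, fourier_norm, mul_one, norm_mul]
    exact hs.mul_right _
  obtain ⟨f, hf⟩ := hsum
  refine ⟨f, ?_⟩
  have h1 := (ContinuousMap.toLp (E := ℂ) 2 (volume : Measure Circle2Pi) ℂ).hasSum hf
  have h2 := planeWaveBasis.hasSum_repr u
  have h3 : ∀ k : ℤ, planeWaveBasis.repr u k • planeWaveBasis k
      = ContinuousMap.toLp (E := ℂ) 2 (volume : Measure Circle2Pi) ℂ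
        ((coeff u k * (((√(2 * π))⁻¹ : ℝ) : ℂ)) • (fourier k : C(Circle2Pi, ℂ))) := by
    intro k
    rw [planeWaveBasis_repr, planeWaveBasis, HilbertBasis.coe_mk, map_smul, planeWave, smul_smul]
  simp_rw [h3] at h2
  rw [h2.unique h1]
  exact ContinuousMap.coeFn_toLp _ _

theorem memLp_mul (V u : L2per) (hu : u ∈ sobolev 1) :
    MemLp (fun x => V x * u x) 2 (volume : Measure Circle2Pi) := by
  obtain ⟨f, hf⟩ := exists_continuous u hu
  have h : MemLp (fun x => V x * f x) 2 (volume : Measure Circle2Pi) := by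
    refine ((Lp.memLp V).norm.const_mul ‖f‖).mono
      ((Lp.memLp V).1.mul f.continuous.aestronglyMeasurable) (Filter.Eventually.of_forall ?_)
    intro x
    simp only [norm_mul, norm_norm]
    rw [mul_comm]
    exact mul_le_mul_of_nonneg_right (f.norm_coe_le_norm x) (norm_nonneg _)
  refine h.ae_eq ?_
  filter_upwards [hf] with x hx
  rw [hx]

/-- Multiplication by the potential `V ∈ L²_per`, as an operator `H¹_per → L²_per`. -/
def mulPotential (V : L2per) : sobolev 1 →ₗ[ℂ] L2per where
  toFun u := (memLp_mul V u u.2).toLp (fun x => V x * (u : L2per) x)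
  map_add' u v := by
    rw [← MemLp.toLp_add]
    refine MemLp.toLp_congr _ _ ?_
    filter_upwards [Lp.coeFn_add (u : L2per) (v : L2per)] with x hx
    simp only [Submodule.coe_add, Pi.add_apply, hx, mul_add]
  map_smul' c u := by
    rw [RingHom.id_apply, ← MemLp.toLp_const_smul]
    refine MemLp.toLp_congr _ _ ?_
    filter_upwards [Lp.coeFn_smul c (u : L2per)] with x hx
    simp only [Submodule.coe_smul, Pi.smul_apply, hx, smul_eq_mul, mul_left_comm]

/-- The Schrödinger operator `H = -Δ + V` on `L²_per`, with domain `H²_per`. -/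
def schrodinger (V : L2per) : L2per →ₗ.[ℂ] L2per where
  domain := sobolev 2
  toFun := -laplacian + (mulPotential V).comp (Submodule.inclusion sobolev_two_le_one)

/-- The kernel `Ker(T - μ)` of an unbounded operator `T` shifted by a real number `μ`. -/
def eigenspace (T : L2per →ₗ.[ℂ] L2per) (μ : ℝ) : Submodule ℂ L2per :=
  (LinearMap.ker (T.toFun - (μ : ℂ) • T.domain.subtype)).map T.domain.subtype

theorem mem_eigenspace {T : L2per →ₗ.[ℂ] L2per} {μ : ℝ} {u : L2per} :
    u ∈ eigenspace T μ ↔ ∃ h : u ∈ T.domain, T ⟨u, h⟩ = (μ : ℂ) • u := by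
  simp only [eigenspace, Submodule.mem_map, LinearMap.mem_ker]
  constructor
  · rintro ⟨v, hv, rfl⟩
    exact ⟨v.2, sub_eq_zero.mp hv⟩
  · rintro ⟨h, hv⟩
    exact ⟨⟨u, h⟩, sub_eq_zero.mpr hv, rfl⟩

/-- The planewave space `X_N = Span(e_k, |k| ≤ N)`. -/
def planeWaveSpace (N : ℝ) : Submodule ℂ L2per :=
  Submodule.span ℂ (planeWave '' {k : ℤ | |(k : ℝ)| ≤ N})

theorem coeff_planeWave (i k : ℤ) : coeff (planeWave i) k = if k = i then 1 else 0 :=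
  orthonormal_iff_ite.mp orthonormal_planeWave k i

theorem planeWave_mem_sobolev (s : ℝ) (i : ℤ) : planeWave i ∈ sobolev s := by
  change Summable fun k : ℤ => (1 + (k : ℝ) ^ 2) ^ s * ‖coeff (planeWave i) k‖ ^ 2
  refine summable_of_hasFiniteSupport ((Set.finite_singleton i).subset ?_)
  intro k hk
  by_contra h
  have h' : k ≠ i := h
  simp [coeff_planeWave, h'] at hk

theorem planeWaveSpace_le_sobolev (N s : ℝ) : planeWaveSpace N ≤ sobolev s := by
  rw [planeWaveSpace, Submodule.span_le]
  rintro _ ⟨k, -, rfl⟩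
  exact planeWave_mem_sobolev s k

/-- The sesquilinear form `a(u, v) = ∫ conj(∇u) ∇v + ∫ V conj(u) v` of `-Δ + V` on `H¹_per`,
conjugate-linear in `u`. -/
def energyForm (V : L2per) (u v : sobolev 1) : ℂ :=
  (∫ x, conj (grad u x) * grad v x) + ∫ x, V x * (conj ((u : L2per) x) * (v : L2per) x)

theorem energyForm_eq (V : L2per) (u v : sobolev 1) :
    energyForm V u v = inner ℂ (grad u) (grad v) + inner ℂ (u : L2per) (mulPotential V v) := by
  rw [energyForm, L2.inner_def, L2.inner_def]
  congr 1
  · simp only [RCLike.inner_apply']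
  · refine integral_congr_ae ?_
    filter_upwards [(memLp_mul V v v.2).coeFn_toLp] with x hx
    have : (mulPotential V v : L2per) x = V x * (v : L2per) x := hx
    rw [this, RCLike.inner_apply']
    ring

/-- The discrete eigenspace: all `u ∈ X_N` with `a(u, v) = μ (u, v)` for all `v ∈ X_N`. -/
def discreteEigenspace (V : L2per) (N : ℝ) (μ : ℝ) : Submodule ℂ L2per where
  carrier := {u | ∃ hu : u ∈ planeWaveSpace N, ∀ (v : L2per) (hv : v ∈ planeWaveSpace N),
    energyForm V ⟨u, planeWaveSpace_le_sobolev N 1 hu⟩ ⟨v, planeWaveSpace_le_sobolev N 1 hv⟩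
      = (μ : ℂ) * ∫ x, conj (u x) * v x}
  zero_mem' := by
    refine ⟨zero_mem _, fun v hv => ?_⟩
    have h0 : (⟨0, planeWaveSpace_le_sobolev N 1 (zero_mem _)⟩ : sobolev 1) = 0 := rfl
    have h1 := L2.inner_def (𝕜 := ℂ) (0 : L2per) v
    simp only [RCLike.inner_apply', inner_zero_left] at h1
    rw [energyForm_eq, h0, ← h1]
    simp
  add_mem' := by
    rintro u u' ⟨hu, h⟩ ⟨hu', h'⟩
    refine ⟨add_mem hu hu', fun v hv => ?_⟩
    have e1 := h v hv
    have e2 := h' v hv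
    have i1 := L2.inner_def (𝕜 := ℂ) u v
    have i2 := L2.inner_def (𝕜 := ℂ) u' v
    have i3 := L2.inner_def (𝕜 := ℂ) (u + u') v
    simp only [RCLike.inner_apply'] at i1 i2 i3
    rw [energyForm_eq, ← i1] at e1
    rw [energyForm_eq, ← i2] at e2
    have hs : (⟨u + u', planeWaveSpace_le_sobolev N 1 (add_mem hu hu')⟩ : sobolev 1)
      = ⟨u, planeWaveSpace_le_sobolev N 1 hu⟩ + ⟨u', planeWaveSpace_le_sobolev N 1 hu'⟩ := rfl
    rw [energyForm_eq, ← i3, hs, map_add, inner_add_left, Submodule.coe_add, inner_add_left,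
      inner_add_left, mul_add, ← e1, ← e2]
    ring
  smul_mem' := by
    rintro c u ⟨hu, h⟩
    refine ⟨Submodule.smul_mem _ c hu, fun v hv => ?_⟩
    have e1 := h v hv
    have i1 := L2.inner_def (𝕜 := ℂ) u v
    have i3 := L2.inner_def (𝕜 := ℂ) (c • u) v
    simp only [RCLike.inner_apply'] at i1 i3
    rw [energyForm_eq, ← i1] at e1
    have hs : (⟨c • u, planeWaveSpace_le_sobolev N 1 (Submodule.smul_mem _ c hu)⟩ : sobolev 1)
      = c • ⟨u, planeWaveSpace_le_sobolev N 1 hu⟩ := rfl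
    rw [energyForm_eq, ← i3, hs, map_smul, inner_smul_left, Submodule.coe_smul, inner_smul_left,
      inner_smul_left, mul_left_comm, ← e1]
    ring

/-- `μ` is the `j`-th lowest eigenvalue (`j ≥ 1`), counting multiplicities, of an eigenvalue
problem with eigenspaces `E ν`, `ν ∈ ℝ`: fewer than `j` linearly independent eigenvectors have
an eigenvalue `< μ`, and at least `j` have an eigenvalue `≤ μ`. -/
def IsLowestEigenvalue (E : ℝ → Submodule ℂ L2per) (j : ℕ) (μ : ℝ) : Prop :=
  Module.rank ℂ ↥(⨆ ν : ℝ, ⨆ _ : ν < μ, E ν) < j ∧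
    (j : Cardinal) ≤ Module.rank ℂ ↥(⨆ ν : ℝ, ⨆ _ : ν ≤ μ, E ν)

/-- The `j`-th lowest eigenvalue is unique if it exists. -/
theorem IsLowestEigenvalue.unique {E : ℝ → Submodule ℂ L2per} {j : ℕ} {μ μ' : ℝ}
    (h : IsLowestEigenvalue E j μ) (h' : IsLowestEigenvalue E j μ') : μ = μ' := by
  have key : ∀ {a b : ℝ}, IsLowestEigenvalue E j a → IsLowestEigenvalue E j b → ¬ a < b := by
    intro a b ha hb hab
    refine absurd (ha.2.trans (Submodule.rank_mono ?_)) (not_le.mpr hb.1)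
    exact iSup₂_le fun ν hν => le_iSup₂_of_le ν (lt_of_le_of_lt hν hab) le_rfl
  exact le_antisymm (not_lt.mp (key h' h)) (not_lt.mp (key h h'))

/-- The `j`-th lowest eigenvalue is an eigenvalue. -/
theorem IsLowestEigenvalue.ne_bot {E : ℝ → Submodule ℂ L2per} {j : ℕ} {μ : ℝ}
    (h : IsLowestEigenvalue E j μ) : E μ ≠ ⊥ := by
  intro h0
  refine absurd (h.2.trans (Submodule.rank_mono ?_)) (not_le.mpr h.1)
  refine iSup₂_le fun ν hν => ?_
  rcases hν.lt_or_eq with h1 | h1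
  · exact le_iSup₂_of_le ν h1 le_rfl
  · rw [h1, h0]
    exact bot_le

/-- The `H^s_per`-distance from `u ∈ H^s_per` to a subspace `E` of `H^s_per`. -/
def sobolevDist (s : ℝ) (u : L2per) (E : Submodule ℂ L2per) : ℝ :=
  ⨅ v : E, sobolevNorm s (u - v)

end Planewave

end

namespace Planewave

open Filter Topology

/-! ### Fourier coefficients -/

/-! Since `V` lies in `H¹`, it has a continuous representative, so multiplication by `V` is a
bounded symmetric operator `M`. The operator `-Δ + M` is then handled through its `graph`, a
coefficientwise relation between `u` and `f = -Δu + Mu`: the graph is closed, and the domain `H²` is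
recovered from it automatically.

Exact and discrete eigenpairs are treated alike. For a subspace `X`, a Ritz pair satisfies `-Δu + Mu
= μu + r` with `u ∈ X` and `r ⟂ X`; `X = X_N` is the discrete problem, and `X = ⊤` forces `r = 0`.
Min-max (`IsRitzFamily.le_of_le`) makes Ritz values decrease as `X` grows. Bounded subsets of the
graph have totally bounded first components, so the Ritz pairs of `X_N` converge along a subsequence
to the lowest eigenpairs of `-Δ + M` (`exists_isRitzFamily_top`). This gives existence of `λ_j` and
convergence of `λ_{j,N}`, without a rate.

The rate comes from the residual. Compactness yields a gap `δ` of `-Δ + M - λ` on the complement of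
its kernel (`exists_gap`). Once `|λ_{j,N} - λ| ≤ δ/2`, the `L²` and `H¹` errors are `O(‖r‖)` and the
eigenvalue error is `O(‖r‖²)` (`exists_mem_graphKernel_near`). The finitely bounded range of
remaining `N` is absorbed in the constant.

Finally `r` is the part of `Mu` at frequencies above `N`. In Fourier variables `M` is a convolution
with an exponentially decaying sequence, while `k²` dominates it at high frequency. Looking at the
frequency where `e^{A'|k|} |û_k|` is largest bounds this weighted maximum uniformly in `N`
(`exists_exp_decay_eigenvector`), whence `‖r‖ ≤ C e^{-AN}` for `A < A'`. -/

theorem coeff_sub (u v : L2per) (k : ℤ) : coeff (u - v) k = coeff u k - coeff v k :=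
  inner_sub_right _ _ _

theorem coeff_zero (k : ℤ) : coeff 0 k = 0 := inner_zero_right _

theorem coeff_sum {ι : Type*} (s : Finset ι) (f : ι → L2per) (k : ℤ) :
    coeff (∑ i ∈ s, f i) k = ∑ i ∈ s, coeff (f i) k := inner_sum _ _ _

theorem continuous_coeff (k : ℤ) : Continuous fun u => coeff u k :=
  continuous_const.inner continuous_id

theorem ext_coeff {u v : L2per} (h : ∀ k, coeff u k = coeff v k) : u = v := by
  apply planeWaveBasis.repr.injective
  ext k
  rw [planeWaveBasis_repr, planeWaveBasis_repr, h]

theorem norm_coeff_le (u : L2per) (k : ℤ) : ‖coeff u k‖ ≤ ‖u‖ := by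
  have h := norm_inner_le_norm (𝕜 := ℂ) (planeWave k) u
  rwa [orthonormal_planeWave.1 k, one_mul] at h

theorem hasSum_inner_coeff (u v : L2per) :
    HasSum (fun k => conj (coeff u k) * coeff v k) (inner ℂ u v) := by
  have h := planeWaveBasis.hasSum_inner_mul_inner u v
  simpa only [planeWaveBasis, HilbertBasis.coe_mk, coeff, inner_conj_symm] using h

theorem hasSum_norm_coeff_sq (u : L2per) : HasSum (fun k => ‖coeff u k‖ ^ 2) (‖u‖ ^ 2) := by
  have h := hasSum_inner_coeff u u
  simp_rw [Complex.conj_mul'] at h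
  rw [inner_self_eq_norm_sq_to_K] at h
  have h' := Complex.hasSum_re h
  simpa [← Complex.ofReal_pow] using h'

theorem hasSum_coeff_smul (u : L2per) : HasSum (fun k => coeff u k • planeWave k) u := by
  have h := planeWaveBasis.hasSum_repr u
  simp_rw [planeWaveBasis_repr] at h
  simpa only [planeWaveBasis, HilbertBasis.coe_mk] using h

theorem norm_le_of_coeff_le {u v : L2per} {c : ℝ} (hc : 0 ≤ c)
    (h : ∀ k, ‖coeff u k‖ ≤ c * ‖coeff v k‖) : ‖u‖ ≤ c * ‖v‖ := by
  refine (sq_le_sq₀ (norm_nonneg _) (by positivity)).mp ?_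
  rw [mul_pow]
  refine hasSum_le (fun k => ?_) (hasSum_norm_coeff_sq u) ((hasSum_norm_coeff_sq v).mul_left _)
  rw [← mul_pow]
  exact pow_le_pow_left₀ (norm_nonneg _) (h k) 2

/-! ### Fourier truncation -/

/-- The partial Fourier sum over a finite set of frequencies. -/
noncomputable def truncation (s : Finset ℤ) : L2per →ₗ[ℂ] L2per where
  toFun u := ∑ k ∈ s, coeff u k • planeWave k
  map_add' u v := by simp only [coeff_add, add_smul, Finset.sum_add_distrib]
  map_smul' c u := by simp only [coeff_smul, mul_smul, Finset.smul_sum, RingHom.id_apply]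

theorem truncation_apply (s : Finset ℤ) (u : L2per) :
    truncation s u = ∑ k ∈ s, coeff u k • planeWave k := rfl

theorem coeff_sum_planeWave (s : Finset ℤ) (a : ℤ → ℂ) (k : ℤ) :
    coeff (∑ l ∈ s, a l • planeWave l) k = if k ∈ s then a k else 0 := by
  simp [coeff_sum, coeff_smul, coeff_planeWave]

theorem coeff_truncation (s : Finset ℤ) (u : L2per) (k : ℤ) :
    coeff (truncation s u) k = if k ∈ s then coeff u k else 0 :=
  coeff_sum_planeWave s _ k

theorem norm_truncation_le (s : Finset ℤ) (u : L2per) : ‖truncation s u‖ ≤ ‖u‖ := by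
  have h : ‖truncation s u‖ ≤ 1 * ‖u‖ := by
    refine norm_le_of_coeff_le zero_le_one fun k => ?_
    rw [coeff_truncation, one_mul]
    split_ifs
    · rfl
    · simp
  rwa [one_mul] at h

theorem tendsto_truncation (u : L2per) :
    Tendsto (fun n : ℕ => truncation (Finset.Icc (-(n : ℤ)) n) u) atTop (𝓝 u) :=
  (hasSum_coeff_smul u).comp Finset.tendsto_Icc_neg

/-- The frequencies of the planewave space `X_N`. -/
noncomputable def frequencies (N : ℝ) : Finset ℤ := Finset.Icc (-⌊N⌋) ⌊N⌋

theorem mem_frequencies {N : ℝ} {k : ℤ} : k ∈ frequencies N ↔ |(k : ℝ)| ≤ N := by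
  rw [frequencies, Finset.mem_Icc, abs_le, Int.le_floor, neg_le, Int.le_floor, Int.cast_neg,
    neg_le]

theorem frequencies_natCast (n : ℕ) : frequencies n = Finset.Icc (-(n : ℤ)) n := by
  rw [frequencies, Int.floor_natCast]

theorem planeWaveSpace_eq_span (N : ℝ) :
    planeWaveSpace N = Submodule.span ℂ (planeWave '' (frequencies N : Set ℤ)) := by
  rw [planeWaveSpace]
  congr 2
  ext k
  simp [mem_frequencies]

theorem mem_planeWaveSpace {N : ℝ} {u : L2per} :
    u ∈ planeWaveSpace N ↔ ∀ k ∉ frequencies N, coeff u k = 0 := by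
  constructor
  · intro hu k hk
    rw [planeWaveSpace_eq_span] at hu
    induction hu using Submodule.span_induction with
    | mem x hx =>
      obtain ⟨l, hl, rfl⟩ := hx
      rw [coeff_planeWave, if_neg]
      rintro rfl
      exact hk hl
    | zero => exact coeff_zero k
    | add x y _ _ hx hy => rw [coeff_add, hx, hy, add_zero]
    | smul c x _ hx => rw [coeff_smul, hx, mul_zero]
  · intro h
    have hu : u = ∑ k ∈ frequencies N, coeff u k • planeWave k := ext_coeff fun k => by
      rw [coeff_sum_planeWave]
      split_ifs with hk
      · rfl
      · exact h k hk
    rw [hu, planeWaveSpace_eq_span]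
    exact Submodule.sum_mem _ fun k hk =>
      Submodule.smul_mem _ _ (Submodule.subset_span ⟨k, hk, rfl⟩)

theorem sum_planeWave_mem (N : ℝ) (a : ℤ → ℂ) :
    ∑ k ∈ frequencies N, a k • planeWave k ∈ planeWaveSpace N :=
  mem_planeWaveSpace.mpr fun k hk => by rw [coeff_sum_planeWave, if_neg hk]

theorem truncation_eq_self {N : ℝ} {u : L2per} (hu : u ∈ planeWaveSpace N) :
    truncation (frequencies N) u = u :=
  ext_coeff fun k => by
    rw [coeff_truncation]
    split_ifs with hk
    · rfl
    · exact (mem_planeWaveSpace.mp hu k hk).symm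

theorem truncation_mem (N : ℝ) (u : L2per) : truncation (frequencies N) u ∈ planeWaveSpace N :=
  sum_planeWave_mem N _

theorem planeWave_mem_planeWaveSpace {N : ℝ} {k : ℤ} (hk : k ∈ frequencies N) :
    planeWave k ∈ planeWaveSpace N := by
  rw [planeWaveSpace_eq_span]
  exact Submodule.subset_span ⟨k, hk, rfl⟩

theorem mem_planeWaveSpace_orthogonal {N : ℝ} {u : L2per} :
    u ∈ (planeWaveSpace N)ᗮ ↔ ∀ k ∈ frequencies N, coeff u k = 0 := by
  rw [Submodule.mem_orthogonal]
  constructor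
  · exact fun h k hk => h _ (planeWave_mem_planeWaveSpace hk)
  · intro h v hv
    rw [planeWaveSpace_eq_span] at hv
    induction hv using Submodule.span_induction with
    | mem x hx =>
      obtain ⟨l, hl, rfl⟩ := hx
      exact h l hl
    | zero => exact inner_zero_left _
    | add x y _ _ hx hy => rw [inner_add_left, hx, hy, add_zero]
    | smul c x _ hx => rw [inner_smul_left, hx, mul_zero]

theorem planeWaveSpace_mono {N N' : ℝ} (h : N ≤ N') : planeWaveSpace N ≤ planeWaveSpace N' :=
  fun _ hu => mem_planeWaveSpace.mpr fun k hk => mem_planeWaveSpace.mp hu k fun hk' =>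
    hk (mem_frequencies.mpr ((mem_frequencies.mp hk').trans h))

instance finiteDimensional_planeWaveSpace (N : ℝ) : FiniteDimensional ℂ (planeWaveSpace N) := by
  rw [planeWaveSpace_eq_span]
  exact FiniteDimensional.span_of_finite ℂ ((frequencies N).finite_toSet.image _)

theorem finrank_planeWaveSpace {N : ℝ} (hN : 0 ≤ N) :
    Module.finrank ℂ (planeWaveSpace N) = 2 * ⌊N⌋₊ + 1 := by
  have h := finrank_span_eq_card (R := ℂ)
    (orthonormal_planeWave.linearIndependent.comp
      (fun k : frequencies N => (k : ℤ)) Subtype.val_injective)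
  have hs : Set.range (planeWave ∘ fun k : frequencies N => (k : ℤ))
      = planeWave '' (frequencies N : Set ℤ) := by
    rw [Set.range_comp, Subtype.range_coe_subtype]
    rfl
  rw [hs, ← planeWaveSpace_eq_span] at h
  rw [h, Fintype.card_coe, frequencies, Int.card_Icc, ← Int.natCast_floor_eq_floor hN]
  omega

/-! ### The graph of `-Δ + M` -/

/-- The graph of the operator `-Δ + M`, in terms of Fourier coefficients. -/
noncomputable def graph (M : L2per →L[ℂ] L2per) : Submodule ℂ (L2per × L2per) where
  carrier := {p | ∀ k : ℤ, coeff p.2 k = (k : ℂ) ^ 2 * coeff p.1 k + coeff (M p.1) k}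
  zero_mem' k := by simp [coeff_zero]
  add_mem' {p q} hp hq k := by
    simp only [Prod.snd_add, Prod.fst_add, map_add, coeff_add, hp k, hq k]
    ring
  smul_mem' c p hp k := by
    simp only [Prod.smul_snd, Prod.smul_fst, map_smul, coeff_smul, hp k]
    ring

variable {M : L2per →L[ℂ] L2per}

theorem mem_graph {u f : L2per} :
    (u, f) ∈ graph M ↔ ∀ k : ℤ, coeff f k = (k : ℂ) ^ 2 * coeff u k + coeff (M u) k := Iff.rfl

/-- Each condition involves a single Fourier coefficient, which is continuous in `L²`. This lets
limits of approximate eigenvectors be eigenvectors without any domain check. -/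
theorem isClosed_graph : IsClosed (graph M : Set (L2per × L2per)) := by
  change IsClosed {p : L2per × L2per |
    ∀ k : ℤ, coeff p.2 k = (k : ℂ) ^ 2 * coeff p.1 k + coeff (M p.1) k}
  rw [Set.ofPred_forall]
  refine isClosed_iInter fun k => isClosed_eq ((continuous_coeff k).comp continuous_snd) ?_
  exact (continuous_const.mul ((continuous_coeff k).comp continuous_fst)).add
    ((continuous_coeff k).comp (M.continuous.comp continuous_fst))

/-- `f - M u` is the image of `u` under the real Fourier multiplier `k²`, so Parseval moves it
across the inner product. -/
theorem graph_inner_symm (hM : M.IsSymmetric) {u f v g : L2per} (hu : (u, f) ∈ graph M)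
    (hv : (v, g) ∈ graph M) : inner ℂ f v = inner ℂ u g := by
  have h1 := hasSum_inner_coeff (f - M u) v
  have h2 := hasSum_inner_coeff u (g - M v)
  have h3 := h1.unique (h2.congr_fun fun k => ?_)
  · rw [inner_sub_left, inner_sub_right, show inner ℂ (M u) v = inner ℂ u (M v) from hM u v] at h3
    exact sub_left_inj.mp h3
  · rw [coeff_sub, coeff_sub, mem_graph.mp hu k, mem_graph.mp hv k, add_sub_cancel_right,
      add_sub_cancel_right, map_mul, map_pow, map_intCast]
    ring

theorem exists_mem_graph {N : ℝ} {u : L2per} (hu : u ∈ planeWaveSpace N) :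
    ∃ f, (u, f) ∈ graph M := by
  refine ⟨∑ k ∈ frequencies N, ((k : ℂ) ^ 2 * coeff u k) • planeWave k + M u, fun k => ?_⟩
  rw [coeff_add, coeff_sum_planeWave]
  split_ifs with hk
  · rfl
  · rw [mem_planeWaveSpace.mp hu k hk, mul_zero]

/-- Truncation commutes with the Laplacian but not with `M`, hence only the part `f - M u` gets
truncated. -/
theorem truncation_mem_graph (s : Finset ℤ) {u f : L2per} (hu : (u, f) ∈ graph M) :
    (truncation s u, truncation s (f - M u) + M (truncation s u)) ∈ graph M := by
  intro k
  dsimp only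
  rw [coeff_add, coeff_truncation, coeff_truncation]
  split_ifs
  · rw [coeff_sub, mem_graph.mp hu k, add_sub_cancel_right]
  · rw [mul_zero]

theorem hasSum_sobolev_one_of_mem_graph {u f : L2per} (hu : (u, f) ∈ graph M) :
    HasSum (fun k : ℤ => (1 + (k : ℝ) ^ 2) * ‖coeff u k‖ ^ 2)
      (‖u‖ ^ 2 + (inner ℂ u (f - M u)).re) := by
  have h := (hasSum_norm_coeff_sq u).add (Complex.hasSum_re (hasSum_inner_coeff u (f - M u)))
  refine h.congr_fun fun k => ?_
  rw [coeff_sub, mem_graph.mp hu k, add_sub_cancel_right, mul_left_comm, Complex.conj_mul']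
  have h1 : (k : ℂ) ^ 2 * (‖coeff u k‖ : ℂ) ^ 2 = (((k : ℝ) ^ 2 * ‖coeff u k‖ ^ 2 : ℝ) : ℂ) := by
    push_cast
    rfl
  rw [h1, Complex.ofReal_re]
  ring

/-- The squared `H¹` norm is `‖u‖² + (u, -Δu)`, and `-Δu = f - M u` with `M` bounded. This turns
`L²` control of the residual into an `H¹` error bound. -/
theorem sobolevNorm_one_sq_le {u f : L2per} (hu : (u, f) ∈ graph M) :
    sobolevNorm 1 u ^ 2 ≤ (1 + ‖M‖) * ‖u‖ ^ 2 + (inner ℂ u f).re := by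
  have h := hasSum_sobolev_one_of_mem_graph hu
  have h0 : 0 ≤ ‖u‖ ^ 2 + (inner ℂ u (f - M u)).re := h.nonneg fun k => by positivity
  simp_rw [sobolevNorm, Real.rpow_one]
  rw [h.tsum_eq, Real.sq_sqrt h0, inner_sub_right, Complex.sub_re]
  have h1 : -(inner ℂ u (M u)).re ≤ ‖M‖ * ‖u‖ ^ 2 := by
    refine (neg_le_abs _).trans ((Complex.abs_re_le_norm _).trans ?_)
    refine (norm_inner_le_norm u (M u)).trans ?_
    nlinarith [M.le_opNorm u, norm_nonneg u]
  linarith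

theorem neg_opNorm_mul_le_inner {u f : L2per} (hu : (u, f) ∈ graph M) :
    -‖M‖ * ‖u‖ ^ 2 ≤ (inner ℂ u f).re := by
  have h0 : 0 ≤ (inner ℂ u (f - M u)).re := by
    refine (Complex.hasSum_re (hasSum_inner_coeff u (f - M u))).nonneg fun k => ?_
    rw [coeff_sub, mem_graph.mp hu k, add_sub_cancel_right, mul_left_comm, Complex.conj_mul']
    norm_cast
    positivity
  rw [inner_sub_right, Complex.sub_re] at h0
  have h1 : -(inner ℂ u (M u)).re ≤ ‖M‖ * ‖u‖ ^ 2 := by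
    refine (neg_le_abs _).trans ((Complex.abs_re_le_norm _).trans ?_)
    refine (norm_inner_le_norm u (M u)).trans ?_
    nlinarith [M.le_opNorm u, norm_nonneg u]
  linarith

theorem graph_unique {u f g : L2per} (hf : (u, f) ∈ graph M) (hg : (u, g) ∈ graph M) : f = g :=
  ext_coeff fun k => by rw [mem_graph.mp hf k, mem_graph.mp hg k]

/-! ### Lowest eigenpairs of the compression of `-Δ + M` to a subspace -/

/-- `u₀, …, u_m` are orthonormal eigenvectors, for the eigenvalues `μ₀ ≤ … ≤ μ_m`, of the
compression of `-Δ + M` to the subspace `X`, and these are the lowest ones. -/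
structure IsRitzFamily (M : L2per →L[ℂ] L2per) (X : Submodule ℂ L2per) {m : ℕ}
    (u : Fin (m + 1) → L2per) (μ : Fin (m + 1) → ℝ) : Prop where
  mono : Monotone μ
  orth : Orthonormal ℂ u
  mem : ∀ i, u i ∈ X
  eig : ∀ i, ∃ r ∈ Xᗮ, (u i, (μ i : ℂ) • u i + r) ∈ graph M
  lower : ∀ i x f, x ∈ X → (x, f) ∈ graph M → (∀ l < i, inner ℂ (u l) x = 0) →
    μ i * ‖x‖ ^ 2 ≤ (inner ℂ x f).re

/-- The compression of `-Δ + M` to the planewave space `X_N`. -/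
noncomputable def compression (M : L2per →L[ℂ] L2per) (N : ℝ) :
    planeWaveSpace N →ₗ[ℂ] planeWaveSpace N where
  toFun u := ⟨∑ k ∈ frequencies N,
    ((k : ℂ) ^ 2 * coeff u k + coeff (M u) k) • planeWave k, sum_planeWave_mem N _⟩
  map_add' u v := by
    ext1
    simp only [Submodule.coe_add, map_add, coeff_add, ← Finset.sum_add_distrib, ← add_smul]
    refine Finset.sum_congr rfl fun k _ => ?_
    ring_nf
  map_smul' c u := by
    ext1
    simp only [Submodule.coe_smul, map_smul, coeff_smul, Finset.smul_sum, smul_smul,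
      RingHom.id_apply]
    refine Finset.sum_congr rfl fun k _ => ?_
    ring_nf

theorem coeff_compression {N : ℝ} (u : planeWaveSpace N) (k : ℤ) :
    coeff (compression M N u : L2per) k
      = if k ∈ frequencies N then (k : ℂ) ^ 2 * coeff u k + coeff (M u) k else 0 :=
  coeff_sum_planeWave _ _ k

/-- The Laplacian preserves `X_N`, so the residual is exactly the high-frequency part of `M u`. -/
theorem exists_compression_add_mem_graph {N : ℝ} (u : planeWaveSpace N) :
    ∃ r ∈ (planeWaveSpace N)ᗮ, ((u : L2per), (compression M N u : L2per) + r) ∈ graph M := by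
  refine ⟨M u - truncation (frequencies N) (M u), ?_, fun k => ?_⟩
  · rw [mem_planeWaveSpace_orthogonal]
    intro k hk
    rw [coeff_sub, coeff_truncation, if_pos hk, sub_self]
  · dsimp only
    rw [coeff_add, coeff_sub, coeff_truncation, coeff_compression]
    split_ifs with hk
    · ring
    · rw [mem_planeWaveSpace.mp u.2 k hk]
      ring

theorem inner_eq_zero_of_mem_orthogonal {X : Submodule ℂ L2per} {x r : L2per} (hx : x ∈ X)
    (hr : r ∈ Xᗮ) : inner ℂ x r = 0 := (Submodule.mem_orthogonal X r).mp hr x hx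

theorem compression_isSymmetric (hM : M.IsSymmetric) (N : ℝ) :
    (compression M N).IsSymmetric := by
  intro u v
  obtain ⟨r, hr, hu⟩ := exists_compression_add_mem_graph (M := M) u
  obtain ⟨r', hr', hv⟩ := exists_compression_add_mem_graph (M := M) v
  have h := graph_inner_symm hM hu hv
  rw [inner_add_left, inner_add_right, inner_eq_zero_of_mem_orthogonal u.2 hr',
    inner_eq_zero_symm.mp (inner_eq_zero_of_mem_orthogonal v.2 hr), add_zero, add_zero] at h
  exact h

theorem exists_isRitzFamily_planeWaveSpace (hM : M.IsSymmetric) {N : ℝ} (hN : 0 ≤ N) {m : ℕ}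
    (hm : m + 1 ≤ 2 * ⌊N⌋₊ + 1) :
    ∃ u : Fin (m + 1) → L2per, ∃ μ, IsRitzFamily M (planeWaveSpace N) u μ := by
  -- `LinearMap.IsSymmetric.eigenvalues` is in decreasing order; the sign change makes the Ritz
  -- values increase.
  have hT : (-compression M N).IsSymmetric := fun u v => by
    simp only [LinearMap.neg_apply, inner_neg_left, inner_neg_right,
      compression_isSymmetric hM N u v]
  have hn := finrank_planeWaveSpace hN
  set b := hT.eigenvectorBasis hn with hb
  set e : Fin (2 * ⌊N⌋₊ + 1) → ℝ := fun i => -hT.eigenvalues hn i with he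
  have hbe : ∀ i, compression M N (b i) = (e i : ℂ) • b i := by
    intro i
    have h := hT.apply_eigenvectorBasis hn i
    rw [LinearMap.neg_apply, neg_eq_iff_eq_neg] at h
    rw [hb, h, he]
    simp
  have hemono : Monotone e := fun i l hil => neg_le_neg (hT.eigenvalues_antitone hn hil)
  refine ⟨fun i => b (Fin.castLE hm i), fun i => e (Fin.castLE hm i), ?_, ?_, ?_, ?_, ?_⟩
  · exact fun i l hil => hemono (by simpa using hil)
  · exact (b.orthonormal.comp_linearIsometry (planeWaveSpace N).subtypeₗᵢ).comp _
      (Fin.castLE_injective hm)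
  · exact fun i => (b _).2
  · intro i
    obtain ⟨r, hr, h⟩ := exists_compression_add_mem_graph (M := M) (b (Fin.castLE hm i))
    rw [hbe] at h
    exact ⟨r, hr, h⟩
  · intro i x f hx hf hort
    obtain ⟨r, hr, h⟩ := exists_compression_add_mem_graph (M := M) ⟨x, hx⟩
    rw [graph_unique hf h, inner_add_right, inner_eq_zero_of_mem_orthogonal hx hr, add_zero]
    set y : planeWaveSpace N := ⟨x, hx⟩ with hy
    have h1 : inner ℂ x (compression M N y : L2per)
        = ∑ k, ((e k * ‖inner ℂ (b k) y‖ ^ 2 : ℝ) : ℂ) := by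
      change inner ℂ y (compression M N y) = _
      rw [← b.sum_inner_mul_inner]
      refine Finset.sum_congr rfl fun k _ => ?_
      have h2 : inner ℂ ((e k : ℂ) • b k) y = e k * inner ℂ (b k) y := by
        exact (inner_smul_left (𝕜 := ℂ) (b k) y (e k : ℂ)).trans (by rw [Complex.conj_ofReal])
      rw [← compression_isSymmetric hM N (b k) y, hbe, h2, mul_left_comm, ← inner_conj_symm y (b k), Complex.conj_mul']
      push_cast
      rfl
    have h2 : ‖x‖ ^ 2 = ∑ k, ‖inner ℂ (b k) y‖ ^ 2 := (b.sum_sq_norm_inner_right y).symm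
    rw [h1, ← Complex.ofReal_sum, Complex.ofReal_re, h2, Finset.mul_sum]
    refine Finset.sum_le_sum fun k _ => ?_
    by_cases hk : k < Fin.castLE hm i
    · have h3 : inner ℂ (b k) y = 0 := hort ⟨k, (Fin.lt_def.mp hk).trans i.2⟩ hk
      simp [h3]
    · exact mul_le_mul_of_nonneg_right (hemono (not_lt.mp hk)) (by positivity)

/-- Min-max: the span of `u₀, …, u_i` contains a nonzero `x` orthogonal to `u'₀, …, u'_{i-1}`. The
energy of `x` is at most `μ i * ‖x‖²` from the first family and at least `μ' i * ‖x‖²` from the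
second. -/
theorem IsRitzFamily.le_of_le {X X' : Submodule ℂ L2per} {m : ℕ} {u u' : Fin (m + 1) → L2per}
    {μ μ' : Fin (m + 1) → ℝ} (h : IsRitzFamily M X u μ) (h' : IsRitzFamily M X' u' μ')
    (hX : X ≤ X') (i : Fin (m + 1)) : μ' i ≤ μ i := by
  choose r hr hg using h.eig
  have hi : (i : ℕ) + 1 ≤ m + 1 := i.2
  set v : Fin ((i : ℕ) + 1) → L2per := fun l => u (Fin.castLE hi l) with hv
  have hvo : Orthonormal ℂ v := h.orth.comp _ (Fin.castLE_injective hi)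
  set L : (Fin ((i : ℕ) + 1) → ℂ) →ₗ[ℂ] (Fin i → ℂ) :=
    LinearMap.pi fun k => (innerₛₗ ℂ (u' (Fin.castLE i.2.le k))).comp
      (Fintype.linearCombination ℂ v) with hL
  -- There are `i + 1` unknown coefficients and only `i` orthogonality conditions.
  have hker : LinearMap.ker L ≠ ⊥ := LinearMap.ker_ne_bot_of_finrank_lt (by simp)
  obtain ⟨c, hc, hc0⟩ := Submodule.exists_mem_ne_zero_of_ne_bot hker
  set x : L2per := ∑ l, c l • v l with hx
  have hxc : Fintype.linearCombination ℂ v c = x := Fintype.linearCombination_apply ℂ v c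
  have hxX : x ∈ X := Submodule.sum_mem _ fun l _ => Submodule.smul_mem _ _ (h.mem _)
  set f : L2per := ∑ l, c l • ((μ (Fin.castLE hi l) : ℂ) • v l + r (Fin.castLE hi l)) with hf
  have hgr : (x, f) ∈ graph M := by
    have h1 := Submodule.sum_mem (graph M) (t := Finset.univ) fun l _ =>
      Submodule.smul_mem (graph M) (c l) (hg (Fin.castLE hi l))
    have h2 : ∑ l, c l • (u (Fin.castLE hi l),
        (μ (Fin.castLE hi l) : ℂ) • u (Fin.castLE hi l) + r (Fin.castLE hi l)) = (x, f) := by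
      ext1
      · simp only [Prod.fst_sum, Prod.smul_fst, hx, hv]
      · simp only [Prod.snd_sum, Prod.smul_snd, hf, hv]
    rwa [h2] at h1
  have hlow := h'.lower i x f (hX hxX) hgr fun l hl => by
    have h1 := congrFun (LinearMap.mem_ker.mp hc) ⟨l, hl⟩
    rw [hL, LinearMap.pi_apply, LinearMap.comp_apply, hxc] at h1
    exact h1
  have hxn : ‖x‖ ^ 2 = ∑ l, ‖c l‖ ^ 2 := by
    have h1 := hvo.inner_sum c c Finset.univ
    simp_rw [Complex.conj_mul'] at h1
    rw [← hx, inner_self_eq_norm_sq_to_K] at h1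
    have h2 := congrArg Complex.re h1
    simpa [← Complex.ofReal_pow] using h2
  have hxf : inner ℂ x f = ∑ l, ((μ (Fin.castLE hi l) * ‖c l‖ ^ 2 : ℝ) : ℂ) := by
    rw [hf, inner_sum]
    refine Finset.sum_congr rfl fun l _ => ?_
    rw [inner_smul_right, inner_add_right, inner_smul_right,
      inner_eq_zero_of_mem_orthogonal hxX (hr _), add_zero, hx, hvo.inner_left_fintype,
      mul_left_comm, Complex.mul_conj']
    push_cast
    rfl
  rw [hxf, ← Complex.ofReal_sum, Complex.ofReal_re] at hlow
  have hup : ∑ l, μ (Fin.castLE hi l) * ‖c l‖ ^ 2 ≤ μ i * ‖x‖ ^ 2 := by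
    rw [hxn, Finset.mul_sum]
    refine Finset.sum_le_sum fun l _ => mul_le_mul_of_nonneg_right (h.mono ?_) (by positivity)
    exact Fin.le_def.mpr (Nat.lt_succ_iff.mp l.2)
  have hpos : 0 < ‖x‖ ^ 2 := by
    obtain ⟨l, hl⟩ := Function.ne_iff.mp hc0
    rw [hxn]
    exact Finset.sum_pos' (fun _ _ => by positivity)
      ⟨l, Finset.mem_univ _, by have := norm_pos_iff.mpr hl; positivity⟩
  exact le_of_mul_le_mul_right (hlow.trans hup) hpos

theorem IsRitzFamily.neg_opNorm_le {X : Submodule ℂ L2per} {m : ℕ} {u : Fin (m + 1) → L2per}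
    {μ : Fin (m + 1) → ℝ} (h : IsRitzFamily M X u μ) (i : Fin (m + 1)) : -‖M‖ ≤ μ i := by
  obtain ⟨r, hr, hg⟩ := h.eig i
  have h1 := neg_opNorm_mul_le_inner hg
  rw [inner_add_right, inner_eq_zero_of_mem_orthogonal (h.mem i) hr, add_zero, inner_smul_right,
    inner_self_eq_norm_sq_to_K, h.orth.1 i] at h1
  simpa using h1

theorem inner_eq_zero_of_ne (hM : M.IsSymmetric) {X : Submodule ℂ L2per} {u v r r' : L2per}
    {μ ν : ℝ} (hne : μ ≠ ν) (hu : u ∈ X) (hv : v ∈ X) (hr : r ∈ Xᗮ) (hr' : r' ∈ Xᗮ)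
    (hur : (u, (μ : ℂ) • u + r) ∈ graph M) (hvr : (v, (ν : ℂ) • v + r') ∈ graph M) :
    inner ℂ u v = 0 := by
  have h := graph_inner_symm hM hur hvr
  rw [inner_add_left, inner_add_right, inner_eq_zero_of_mem_orthogonal hu hr',
    inner_eq_zero_symm.mp (inner_eq_zero_of_mem_orthogonal hv hr), add_zero, add_zero,
    inner_smul_left, inner_smul_right, Complex.conj_ofReal] at h
  have h2 : ((μ : ℂ) - ν) * inner ℂ u v = 0 := by rw [sub_mul, h, sub_self]
  refine (mul_eq_zero.mp h2).resolve_left (sub_ne_zero.mpr ?_)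
  exact_mod_cast hne

theorem IsRitzFamily.isLowestEigenvalue (hM : M.IsSymmetric) {X : Submodule ℂ L2per}
    {E : ℝ → Submodule ℂ L2per}
    (hE : ∀ ν u, u ∈ E ν ↔ u ∈ X ∧ ∃ r ∈ Xᗮ, (u, (ν : ℂ) • u + r) ∈ graph M)
    {m : ℕ} {u : Fin (m + 1) → L2per} {μ : Fin (m + 1) → ℝ} (h : IsRitzFamily M X u μ) :
    IsLowestEigenvalue E (m + 1) (μ (Fin.last m)) := by
  have huE : ∀ i, u i ∈ E (μ i) := fun i => (hE _ _).mpr ⟨h.mem i, h.eig i⟩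
  constructor
  · have hle : (⨆ ν : ℝ, ⨆ _ : ν < μ (Fin.last m), E ν)
        ≤ Submodule.span ℂ (Set.range fun i : Fin m => u i.castSucc) := by
      -- Removing from `v` its components along the first `m` Ritz vectors leaves `z` in `E ν`,
      -- since components for Ritz values other than `ν` vanish. The variational lower bound at
      -- index `m` then reads `μ_m ‖z‖² ≤ ν ‖z‖²` with `ν < μ_m`, forcing `z = 0`.
      refine iSup₂_le fun ν hν v hv => ?_
      set z : L2per := v - ∑ i : Fin m, inner ℂ (u i.castSucc) v • u i.castSucc with hz
      have hzE : z ∈ E ν := by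
        refine Submodule.sub_mem _ hv (Submodule.sum_mem _ fun i _ => ?_)
        by_cases hi : μ i.castSucc = ν
        · exact Submodule.smul_mem _ _ (hi ▸ huE i.castSucc)
        · obtain ⟨hvX, r, hr, hg⟩ := (hE _ _).mp hv
          obtain ⟨r', hr', hg'⟩ := h.eig i.castSucc
          rw [inner_eq_zero_of_ne hM hi (h.mem _) hvX hr' hr hg' hg, zero_smul]
          exact zero_mem _
      have hort : ∀ l < Fin.last m, inner ℂ (u l) z = 0 := by
        intro l hl
        obtain ⟨i, rfl⟩ := Fin.exists_castSucc_eq.mpr hl.ne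
        have ho : Orthonormal ℂ fun i : Fin m => u i.castSucc :=
          h.orth.comp _ (Fin.castSucc_injective m)
        have h1 := ho.inner_right_fintype (fun i : Fin m => inner ℂ (u i.castSucc) v) i
        rw [hz, inner_sub_right, h1, sub_self]
      obtain ⟨hzX, r, hr, hg⟩ := (hE _ _).mp hzE
      have hlow := h.lower (Fin.last m) z _ hzX hg hort
      rw [inner_add_right, inner_eq_zero_of_mem_orthogonal hzX hr, add_zero, inner_smul_right,
        inner_self_eq_norm_sq_to_K] at hlow
      have h3 : ((ν : ℂ) * (‖z‖ : ℂ) ^ 2).re = ν * ‖z‖ ^ 2 := by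
        rw [← Complex.ofReal_pow, ← Complex.ofReal_mul, Complex.ofReal_re]
      have h4 : ‖z‖ ^ 2 ≤ 0 := by
        have h5 : μ (Fin.last m) * ‖z‖ ^ 2 ≤ ν * ‖z‖ ^ 2 := hlow.trans h3.le
        nlinarith [sq_nonneg ‖z‖]
      have h5 : z = 0 := by
        rw [← norm_eq_zero]
        exact pow_eq_zero_iff two_ne_zero |>.mp (le_antisymm h4 (by positivity))
      rw [hz, sub_eq_zero] at h5
      rw [h5]
      exact Submodule.sum_mem _ fun i _ =>
        Submodule.smul_mem _ _ (Submodule.subset_span ⟨i, rfl⟩)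
    refine (Submodule.rank_mono hle).trans_lt ?_
    refine ((rank_span_le _).trans Cardinal.mk_range_le).trans_lt ?_
    rw [Cardinal.mk_fin]
    exact_mod_cast Nat.lt_succ_self m
  · have hle : Submodule.span ℂ (Set.range u) ≤ ⨆ ν : ℝ, ⨆ _ : ν ≤ μ (Fin.last m), E ν := by
      rw [Submodule.span_le]
      rintro _ ⟨i, rfl⟩
      exact (le_iSup₂_of_le (f := fun ν (_ : ν ≤ μ (Fin.last m)) => E ν) (μ i)
        (h.mono (Fin.le_last i)) le_rfl) (huE i)
    refine le_trans ?_ (Submodule.rank_mono hle)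
    rw [rank_span h.orth.linearIndependent,
      Cardinal.mk_range_eq _ h.orth.linearIndependent.injective, Cardinal.mk_fin]

/-! ### Compactness -/

/-- Above the cutoff `k² ≥ n + 1`; this crude rate suffices for compactness. -/
theorem norm_sub_truncation_le {u f : L2per} (hu : (u, f) ∈ graph M) (n : ℕ) :
    ‖u - truncation (Finset.Icc (-(n : ℤ)) n) u‖ ≤ 1 / ((n : ℝ) + 1) * ‖f - M u‖ := by
  refine norm_le_of_coeff_le (by positivity) fun k => ?_
  rw [coeff_sub, coeff_truncation]
  split_ifs with hk
  · rw [sub_self, norm_zero]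
    positivity
  · rw [sub_zero, coeff_sub, mem_graph.mp hu k, add_sub_cancel_right, norm_mul, norm_pow,
      Complex.norm_intCast, sq_abs, ← mul_assoc]
    refine le_mul_of_one_le_left (norm_nonneg _) ?_
    rw [one_div, inv_mul_eq_div, one_le_div (by positivity)]
    have h1 : (n : ℤ) + 1 ≤ k ^ 2 := by
      rw [Finset.mem_Icc, ← abs_le, not_le] at hk
      rw [← sq_abs]
      nlinarith
    exact_mod_cast h1

/-- Compactness of the resolvent: up to a uniform truncation error, the set lies in a ball of a
finite-dimensional planewave space. -/
theorem totallyBounded_of_graph_bounded (M : L2per →L[ℂ] L2per) (C : ℝ) :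
    TotallyBounded {u : L2per | ∃ f, (u, f) ∈ graph M ∧ ‖u‖ ≤ C ∧ ‖f‖ ≤ C} := by
  rw [Metric.totallyBounded_iff]
  intro ε hε
  obtain ⟨n, hn⟩ := exists_nat_one_div_lt (show 0 < ε / 2 / (|C| + ‖M‖ * |C| + 1) by positivity)
  rw [lt_div_iff₀ (by positivity)] at hn
  have hb : TotallyBounded
      ((planeWaveSpace n).subtypeL '' (Metric.closedBall (0 : planeWaveSpace n) C)) := by
    have : ProperSpace (planeWaveSpace n) := FiniteDimensional.proper ℂ _
    exact ((isCompact_closedBall _ _).image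
      (planeWaveSpace n).subtypeL.continuous).totallyBounded
  obtain ⟨t, ht, hcov⟩ := Metric.totallyBounded_iff.mp hb (ε / 2) (by positivity)
  refine ⟨t, ht, ?_⟩
  rintro u ⟨f, hu, huC, hfC⟩
  have hmem := truncation_mem n u
  rw [frequencies_natCast] at hmem
  obtain ⟨y, hy, hdist⟩ := Set.mem_iUnion₂.mp (hcov ⟨⟨_, hmem⟩, by
    rw [mem_closedBall_zero_iff]
    exact (norm_truncation_le _ u).trans huC, rfl⟩)
  refine Set.mem_iUnion₂.mpr ⟨y, hy, ?_⟩
  rw [Metric.mem_ball] at hdist ⊢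
  refine (dist_triangle _ (truncation (Finset.Icc (-(n : ℤ)) n) u) y).trans_lt ?_
  refine (add_lt_add_of_le_of_lt ?_ hdist).trans_eq (add_halves ε)
  rw [dist_eq_norm]
  refine (norm_sub_truncation_le hu n).trans (le_trans ?_ hn.le)
  refine mul_le_mul_of_nonneg_left ?_ (by positivity)
  have h1 : ‖M u‖ ≤ ‖M‖ * |C| :=
    (M.le_opNorm u).trans (by gcongr; exact huC.trans (le_abs_self C))
  linarith [norm_sub_le f (M u), le_abs_self C]

/-- The compactness is used in a finite product, so that one subsequence serves all the
eigenvectors. -/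
theorem exists_subseq_tendsto {ι : Type*} [Fintype ι] {C : ℝ} {w f : ℕ → ι → L2per}
    (h : ∀ n i, (w n i, f n i) ∈ graph M) (hw : ∀ n i, ‖w n i‖ ≤ C) (hf : ∀ n i, ‖f n i‖ ≤ C) :
    ∃ u : ι → L2per, ∃ φ : ℕ → ℕ, StrictMono φ ∧
      ∀ i, Tendsto (fun n => w (φ n) i) atTop (𝓝 (u i)) := by
  have hc := (totallyBounded_of_graph_bounded M C).closure.isCompact_of_isClosed isClosed_closure
  have hp := isCompact_univ_pi fun _ : ι => hc
  obtain ⟨u, -, φ, hφ, hlim⟩ := hp.tendsto_subseq (x := w) fun n i _ =>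
    subset_closure ⟨f n i, h n i, hw n i, hf n i⟩
  exact ⟨u, φ, hφ, tendsto_pi_nhds.mp hlim⟩

/-- A lower bound for `-Δ + M - lam` on the orthogonal complement of its kernel. -/
theorem exists_gap (M : L2per →L[ℂ] L2per) (lam : ℝ) :
    ∃ δ : ℝ, 0 < δ ∧ ∀ w f, (w, f) ∈ graph M →
      (∀ v, (v, (lam : ℂ) • v) ∈ graph M → inner ℂ v w = 0) →
      δ * ‖w‖ ≤ ‖f - (lam : ℂ) • w‖ := by
  -- Otherwise, normalized vectors orthogonal to the kernel with residuals tending to `0` have a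
  -- convergent subsequence. Its limit is a unit vector of the kernel that is orthogonal to itself.
  by_contra! hcon
  choose w f hg hort hlt using fun n : ℕ => hcon (1 / ((n : ℝ) + 1)) (by positivity)
  have hw0 : ∀ n, ‖w n‖ ≠ 0 := by
    intro n h0
    have h1 := hlt n
    rw [h0, mul_zero] at h1
    exact absurd h1 (not_lt.mpr (norm_nonneg _))
  set a : ℕ → ℂ := fun n => ((‖w n‖⁻¹ : ℝ) : ℂ) with ha
  have han : ∀ n, ‖a n‖ = ‖w n‖⁻¹ := fun n => by
    rw [ha, Complex.norm_real, norm_inv, norm_norm]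
  have hw1 : ∀ n, ‖a n • w n‖ = 1 := fun n => by
    rw [norm_smul, han, inv_mul_cancel₀ (hw0 n)]
  have hd : ∀ n, ‖a n • f n - (lam : ℂ) • a n • w n‖ ≤ 1 / ((n : ℝ) + 1) := fun n => by
    rw [smul_comm, ← smul_sub, norm_smul, han, inv_mul_le_iff₀ ((norm_nonneg _).lt_of_ne' (hw0 n))]
    exact (mul_comm _ _).trans_ge (hlt n).le
  have hf1 : ∀ n, ‖a n • f n‖ ≤ 1 + |lam| := fun n => by
    have h1 := norm_le_norm_sub_add (a n • f n) ((lam : ℂ) • a n • w n)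
    rw [norm_smul (lam : ℂ), hw1, mul_one, Complex.norm_real, Real.norm_eq_abs] at h1
    refine h1.trans (add_le_add_left ((hd n).trans ?_) _)
    rw [one_div]
    exact inv_le_one_of_one_le₀ (by linarith [(Nat.cast_nonneg n : (0 : ℝ) ≤ n)])
  obtain ⟨u, φ, hφ, hlim⟩ := exists_subseq_tendsto (M := M) (ι := Unit) (C := 1 + |lam|)
    (w := fun n _ => a n • w n) (f := fun n _ => a n • f n)
    (fun n _ => (graph M).smul_mem (a n) (hg n))
    (fun n _ => (hw1 n).trans_le (by linarith [abs_nonneg lam])) (fun n _ => hf1 n)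
  replace hlim := hlim ()
  set v := u ()
  have hd0 : Tendsto (fun n => a n • f n - (lam : ℂ) • a n • w n) atTop (𝓝 0) :=
    squeeze_zero_norm hd tendsto_one_div_add_atTop_nhds_zero_nat
  have hflim : Tendsto (fun n => a (φ n) • f (φ n)) atTop (𝓝 ((lam : ℂ) • v)) := by
    have h1 := (hd0.comp hφ.tendsto_atTop).add (hlim.const_smul (lam : ℂ))
    simpa using h1
  have hv : (v, (lam : ℂ) • v) ∈ graph M :=
    isClosed_graph.mem_of_tendsto (hlim.prodMk_nhds hflim)
      (Eventually.of_forall fun n => (graph M).smul_mem (a (φ n)) (hg (φ n)))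
  have hv1 : ‖v‖ = 1 := tendsto_nhds_unique hlim.norm (by simp only [hw1, tendsto_const_nhds])
  have hv0 : inner ℂ v v = (0 : ℂ) := by
    refine tendsto_nhds_unique (tendsto_const_nhds.inner hlim) ?_
    have h2 : ∀ n, inner ℂ v (a n • w n) = 0 := fun n => by
      rw [inner_smul_right, hort n v hv, mul_zero]
    simp only [h2, tendsto_const_nhds]
  rw [inner_self_eq_zero] at hv0
  rw [hv0, norm_zero] at hv1
  exact zero_ne_one hv1

/-! ### Passage to the limit `N → ∞` -/

theorem coeff_residual {N : ℝ} {u r : L2per} {μ : ℝ} (hu : u ∈ planeWaveSpace N)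
    (hr : r ∈ (planeWaveSpace N)ᗮ) (hg : (u, (μ : ℂ) • u + r) ∈ graph M) (k : ℤ) :
    coeff r k = if k ∈ frequencies N then 0 else coeff (M u) k := by
  split_ifs with hk
  · exact mem_planeWaveSpace_orthogonal.mp hr k hk
  · have h := mem_graph.mp hg k
    rwa [coeff_add, coeff_smul, mem_planeWaveSpace.mp hu k hk, mul_zero, mul_zero, zero_add,
      zero_add] at h

theorem norm_residual_le {N : ℝ} {u r : L2per} {μ : ℝ} (hu : u ∈ planeWaveSpace N)
    (hr : r ∈ (planeWaveSpace N)ᗮ) (hg : (u, (μ : ℂ) • u + r) ∈ graph M) : ‖r‖ ≤ ‖M u‖ := by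
  have h : ‖r‖ ≤ 1 * ‖M u‖ := by
    refine norm_le_of_coeff_le zero_le_one fun k => ?_
    rw [coeff_residual hu hr hg, one_mul]
    split_ifs
    · simp
    · rfl
  rwa [one_mul] at h

theorem coeff_eigenvector {N : ℝ} {u r : L2per} {μ : ℝ} (hr : r ∈ (planeWaveSpace N)ᗮ)
    (hg : (u, (μ : ℂ) • u + r) ∈ graph M) {k : ℤ} (hk : k ∈ frequencies N) :
    μ * coeff u k = (k : ℂ) ^ 2 * coeff u k + coeff (M u) k := by
  rw [← mem_graph.mp hg k, coeff_add, coeff_smul, mem_planeWaveSpace_orthogonal.mp hr k hk,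
    add_zero]

/-- A test vector `w` for the limit is made admissible at level `n` by truncating it and subtracting
its components along the earlier `U n l`. These components tend to `0`, so the discrete lower bound
passes to the limit. -/
theorem lower_bound_of_tendsto {m : ℕ} {ν : ℕ → ℕ} (hν : Tendsto ν atTop atTop)
    {U : ℕ → Fin (m + 1) → L2per} {κ : ℕ → Fin (m + 1) → ℝ}
    (hU : ∀ n, IsRitzFamily M (planeWaveSpace (ν n)) (U n) (κ n))
    {u : Fin (m + 1) → L2per} {μ : Fin (m + 1) → ℝ}
    (hu : ∀ i, Tendsto (fun n => U n i) atTop (𝓝 (u i)))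
    (hμ : ∀ i, Tendsto (fun n => κ n i) atTop (𝓝 (μ i)))
    (i : Fin (m + 1)) {w f : L2per} (hg : (w, f) ∈ graph M)
    (hort : ∀ l < i, inner ℂ (u l) w = 0) : μ i * ‖w‖ ^ 2 ≤ (inner ℂ w f).re := by
  choose r hr hgr using fun n => (hU n).eig
  set P : ℕ → L2per →ₗ[ℂ] L2per := fun n => truncation (frequencies (ν n)) with hP
  have hPlim : ∀ v, Tendsto (fun n => P n v) atTop (𝓝 v) := fun v => by
    simp only [hP, frequencies_natCast]
    exact (tendsto_truncation v).comp hν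
  set c : ℕ → Fin (m + 1) → ℂ := fun n l => inner ℂ (U n l) (P n w) with hc
  set z : ℕ → L2per := fun n => P n w - ∑ l ∈ Finset.Iio i, c n l • U n l with hz
  set F : ℕ → L2per := fun n => P n (f - M w) + M (P n w) with hF
  have hzX : ∀ n, z n ∈ planeWaveSpace (ν n) := fun n =>
    Submodule.sub_mem _ (truncation_mem _ w)
      (Submodule.sum_mem _ fun l _ => Submodule.smul_mem _ _ ((hU n).mem l))
  have hzort : ∀ n, ∀ l < i, inner ℂ (U n l) (z n) = 0 := fun n l hl => by
    simp only [hz]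
    rw [inner_sub_right, (hU n).orth.inner_right_sum _ (Finset.mem_Iio.mpr hl), sub_self]
  have hzg : ∀ n, (z n, F n - ∑ l ∈ Finset.Iio i, c n l • ((κ n l : ℂ) • U n l + r n l))
      ∈ graph M := fun n => by
    have h1 := (graph M).sub_mem (truncation_mem_graph (frequencies (ν n)) hg)
      (Submodule.sum_mem (graph M) (t := Finset.Iio i) fun l _ =>
        Submodule.smul_mem (graph M) (c n l) (hgr n l))
    convert h1 using 1
    ext1
    · simp only [hz, hP, Prod.fst_sub, Prod.fst_sum, Prod.smul_fst]
    · simp only [hF, hP, Prod.snd_sub, Prod.snd_sum, Prod.smul_snd]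
  have hlow : ∀ n, κ n i * ‖z n‖ ^ 2 ≤ (inner ℂ (z n) (F n)).re := fun n => by
    have h1 := (hU n).lower i _ _ (hzX n) (hzg n) (hzort n)
    rw [inner_sub_right, inner_sum, Finset.sum_eq_zero, sub_zero] at h1
    · exact h1
    -- Both parts of the correction drop out: `z n` is orthogonal to `U n l`, and `r n l` is
    -- orthogonal to the whole of `X_N`.
    · intro l hl
      rw [inner_smul_right, inner_add_right, inner_smul_right,
        inner_eq_zero_symm.mp (hzort n l (Finset.mem_Iio.mp hl)),
        inner_eq_zero_of_mem_orthogonal (hzX n) (hr n l), mul_zero, add_zero, mul_zero]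
  have hzlim : Tendsto z atTop (𝓝 w) := by
    have h1 : Tendsto (fun n => ∑ l ∈ Finset.Iio i, c n l • U n l) atTop
        (𝓝 (∑ l ∈ Finset.Iio i, (0 : ℂ) • u l)) := by
      refine tendsto_finsetSum _ fun l hl => Tendsto.smul ?_ (hu l)
      rw [← hort l (Finset.mem_Iio.mp hl)]
      exact (hu l).inner (hPlim w)
    simpa using (hPlim w).sub h1
  have hFlim : Tendsto F atTop (𝓝 f) := by
    have h1 := (hPlim (f - M w)).add ((M.continuous.tendsto w).comp (hPlim w))
    rwa [sub_add_cancel] at h1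
  exact le_of_tendsto_of_tendsto' ((hμ i).mul (hzlim.norm.pow 2))
    ((Complex.continuous_re.tendsto _).comp (hzlim.inner hFlim)) hlow

/-- The lowest eigenpairs of `-Δ + M` exist, and are approximated by those of its compressions to
the planewave spaces. -/
theorem exists_isRitzFamily_top (hM : M.IsSymmetric) (m : ℕ) :
    ∃ u : Fin (m + 1) → L2per, ∃ μ, IsRitzFamily M ⊤ u μ ∧
      ∀ i, ∀ ε > 0, ∃ N₀ : ℝ, ∀ N ≥ N₀, ∀ u' μ', IsRitzFamily M (planeWaveSpace N) u' μ' →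
        μ' i < μ i + ε := by
  -- Starting at `N = m` ensures that `X_N` always has dimension at least `m + 1`.
  choose U κ hU using fun n : ℕ => exists_isRitzFamily_planeWaveSpace hM
    (N := ((m + n : ℕ) : ℝ)) (m := m) (by positivity) (by rw [Nat.floor_natCast]; omega)
  have hanti : ∀ i, Antitone fun n => κ n i := fun i a b hab =>
    (hU a).le_of_le (hU b) (planeWaveSpace_mono (by exact_mod_cast Nat.add_le_add_left hab m)) i
  have hbdd : ∀ i, BddBelow (Set.range fun n => κ n i) := fun i =>
    ⟨-‖M‖, by rintro _ ⟨n, rfl⟩; exact (hU n).neg_opNorm_le i⟩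
  set μ : Fin (m + 1) → ℝ := fun i => ⨅ n, κ n i with hμdef
  have hμ : ∀ i, Tendsto (fun n => κ n i) atTop (𝓝 (μ i)) := fun i =>
    tendsto_atTop_ciInf (hanti i) (hbdd i)
  choose r hr hgr using fun n => (hU n).eig
  have hκ : ∀ n i, |κ n i| ≤ ‖M‖ + ∑ l, |κ 0 l| := fun n i => by
    have h1 := (hU n).neg_opNorm_le i
    have h2 : κ n i ≤ κ 0 i := hanti i (Nat.zero_le n)
    have h3 : |κ 0 i| ≤ ∑ l, |κ 0 l| :=
      Finset.single_le_sum (f := fun l => |κ 0 l|) (fun _ _ => abs_nonneg _) (Finset.mem_univ i)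
    rw [abs_le]
    constructor <;> linarith [le_abs_self (κ 0 i), norm_nonneg M, abs_nonneg (κ 0 i)]
  obtain ⟨u, φ, hφ, hu⟩ := exists_subseq_tendsto (M := M)
    (C := 1 + (‖M‖ + ∑ l, |κ 0 l| + ‖M‖)) (w := U) hgr
    (fun n i => by
      rw [(hU n).orth.1 i]
      have : 0 ≤ ∑ l, |κ 0 l| := Finset.sum_nonneg fun _ _ => abs_nonneg _
      linarith [norm_nonneg M])
    (fun n i => by
      refine (norm_add_le _ _).trans ?_
      rw [norm_smul, (hU n).orth.1 i, mul_one, Complex.norm_real, Real.norm_eq_abs]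
      have h1 := norm_residual_le ((hU n).mem i) (hr n i) (hgr n i)
      have h2 := M.le_opNorm (U n i)
      rw [(hU n).orth.1 i, mul_one] at h2
      linarith [hκ n i])
  have hμφ : ∀ i, Tendsto (fun n => κ (φ n) i) atTop (𝓝 (μ i)) := fun i =>
    (hμ i).comp hφ.tendsto_atTop
  have hν : Tendsto (fun n => m + φ n) atTop atTop :=
    tendsto_atTop_mono (fun n => Nat.le_add_left _ _) hφ.tendsto_atTop
  refine ⟨u, μ, ⟨?_, ?_, fun _ => Submodule.mem_top, ?_, ?_⟩, ?_⟩
  · exact fun i l hil => le_of_tendsto_of_tendsto' (hμ i) (hμ l) fun n => (hU n).mono hil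
  · rw [orthonormal_iff_ite]
    intro i l
    refine tendsto_nhds_unique ((hu i).inner (hu l)) ?_
    simp only [orthonormal_iff_ite.mp (hU _).orth i l, tendsto_const_nhds]
  · intro i
    refine ⟨0, zero_mem _, ?_⟩
    rw [add_zero]
    intro k
    dsimp only
    rw [coeff_smul]
    have hlim : ∀ T : L2per → ℂ, Continuous T →
        Tendsto (fun n => T (U (φ n) i)) atTop (𝓝 (T (u i))) :=
      fun T hT => (hT.tendsto _).comp (hu i)
    refine tendsto_nhds_unique_of_eventuallyEq
      (((Complex.continuous_ofReal.tendsto _).comp (hμφ i)).mul (hlim _ (continuous_coeff k)))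
      (((hlim _ (continuous_coeff k)).const_mul ((k : ℂ) ^ 2)).add
        (hlim _ ((continuous_coeff k).comp M.continuous))) ?_
    -- For fixed `k`, the discrete equation holds exactly at frequency `k` as soon as the cutoff
    -- exceeds `|k|`.
    filter_upwards [hν.eventually_ge_atTop k.natAbs] with n hn
    refine coeff_eigenvector (hr _ i) (hgr _ i) ?_
    rw [frequencies_natCast, Finset.mem_Icc]
    omega
  · exact fun i w f _ hg hort => lower_bound_of_tendsto hν (fun n => hU (φ n)) hu hμφ i hg hort
  · intro i ε hε
    obtain ⟨n, hn⟩ := ((hμ i).eventually_lt_const (lt_add_of_pos_right _ hε)).exists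
    exact ⟨((m + n : ℕ) : ℝ), fun N hN u' μ' h' =>
      ((hU n).le_of_le h' (planeWaveSpace_mono hN) i).trans_lt hn⟩

/-! ### Residual estimates -/

/-- The kernel of `-Δ + M - lam`. -/
noncomputable def graphKernel (M : L2per →L[ℂ] L2per) (lam : ℝ) : Submodule ℂ L2per :=
  (graph M).comap (LinearMap.id.prod ((lam : ℂ) • LinearMap.id))

theorem mem_graphKernel {lam : ℝ} {u : L2per} :
    u ∈ graphKernel M lam ↔ (u, (lam : ℂ) • u) ∈ graph M := Iff.rfl

theorem isClosed_graphKernel (M : L2per →L[ℂ] L2per) (lam : ℝ) :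
    IsClosed (graphKernel M lam : Set L2per) :=
  isClosed_graph.preimage (continuous_id.prodMk (continuous_const_smul (lam : ℂ)))

theorem re_inner_le (u v : L2per) : (inner ℂ u v).re ≤ ‖u‖ * ‖v‖ :=
  (Complex.re_le_norm _).trans (norm_inner_le_norm u v)

theorem inner_self_re (u : L2per) : (inner ℂ u u).re = ‖u‖ ^ 2 := by
  rw [inner_self_eq_norm_sq_to_K]
  exact (congrArg Complex.re (Complex.ofReal_pow ‖u‖ 2).symm).trans (Complex.ofReal_re _)

theorem inner_ofReal_smul_re (u v : L2per) (a : ℝ) :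
    (inner ℂ u ((a : ℂ) • v)).re = a * (inner ℂ u v).re := by
  rw [inner_smul_right, Complex.re_ofReal_mul]

/-- A normalized vector that solves the eigenvalue equation up to a residual is close to the
exact eigenspace, in terms of the residual. -/
theorem exists_mem_graphKernel_near (hM : M.IsSymmetric) {lam δ : ℝ} (hδ : 0 < δ)
    (hgap : ∀ w f, (w, f) ∈ graph M →
      (∀ v, (v, (lam : ℂ) • v) ∈ graph M → inner ℂ v w = 0) → δ * ‖w‖ ≤ ‖f - (lam : ℂ) • w‖)
    {X : Submodule ℂ L2per} {u r : L2per} {μ : ℝ} (hμ : |μ - lam| ≤ δ / 2) (hu : u ∈ X)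
    (hu1 : ‖u‖ = 1) (hr : r ∈ Xᗮ) (hg : (u, (μ : ℂ) • u + r) ∈ graph M) :
    ∃ v ∈ graphKernel M lam, ‖u - v‖ ≤ 2 / δ * ‖r‖ ∧
      sobolevNorm 1 (u - v) ^ 2 ≤ (1 + ‖M‖ + μ) * ‖u - v‖ ^ 2 + ‖u - v‖ * ‖r‖ ∧
      μ - lam ≤ (μ - lam) * ‖u - v‖ ^ 2 + ‖u - v‖ * ‖r‖ := by
  have : CompleteSpace (graphKernel M lam) := (isClosed_graphKernel M lam).completeSpace_coe
  set v : L2per := (graphKernel M lam).starProjection u with hv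
  have hvE : v ∈ graphKernel M lam := Submodule.starProjection_apply_mem _ u
  set w : L2per := u - v with hw
  have hwE : ∀ y ∈ graphKernel M lam, inner ℂ y w = 0 :=
    (Submodule.mem_orthogonal _ _).mp (Submodule.sub_starProjection_mem_orthogonal u)
  set g : L2per := ((μ - lam : ℝ) : ℂ) • u + r with hgdef
  have huv : u = w + v := (sub_add_cancel u v).symm
  have hwg : (w, (lam : ℂ) • w + g) ∈ graph M := by
    have h1 := (graph M).sub_mem hg (mem_graphKernel.mp hvE)
    have h2 : (μ : ℂ) • u + r - (lam : ℂ) • v = (lam : ℂ) • w + g := by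
      rw [hw, hgdef, Complex.ofReal_sub]
      module
    rwa [Prod.mk_sub_mk, h2] at h1
  -- `g` is the image of `w` under `-Δ + M - lam`, so symmetry makes it orthogonal to the kernel.
  have hgE : ∀ y ∈ graphKernel M lam, inner ℂ y g = 0 := fun y hy => by
    have h1 := graph_inner_symm hM (mem_graphKernel.mp hy) hwg
    rw [inner_smul_left, inner_add_right, inner_smul_right, hwE y hy, mul_zero, mul_zero,
      zero_add] at h1
    exact h1.symm
  have hgw : g = ((μ - lam : ℝ) : ℂ) • w + r + ((μ - lam : ℝ) : ℂ) • v := by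
    rw [hgdef, huv]
    module
  -- Being orthogonal to `v`, `g` is bounded by the part of itself without the multiple of `v`; this
  -- replaces `‖u‖ = 1` by the small `‖w‖` in the estimate.
  have hgn : ‖g‖ ≤ |μ - lam| * ‖w‖ + ‖r‖ := by
    have h1 : ‖g‖ ^ 2 = (inner ℂ g (((μ - lam : ℝ) : ℂ) • w + r)).re := by
      rw [← inner_self_re g]
      conv_lhs => rw [hgw, inner_add_left, ← hgw, inner_smul_left, hgE v hvE, mul_zero, add_zero]
      rw [← inner_conj_symm, Complex.conj_re]
    have h2 := re_inner_le g (((μ - lam : ℝ) : ℂ) • w + r)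
    have h3 := norm_add_le (((μ - lam : ℝ) : ℂ) • w) r
    rw [norm_smul, Complex.norm_real, Real.norm_eq_abs] at h3
    rw [← h1] at h2
    rcases (norm_nonneg g).eq_or_lt with h0 | h0
    · rw [← h0]
      positivity
    · exact (le_of_mul_le_mul_left (by rwa [← sq]) h0).trans h3
  -- The term `|μ - lam| * ‖w‖ ≤ (δ / 2) * ‖w‖` is absorbed by the gap.
  have hwn : ‖w‖ ≤ 2 / δ * ‖r‖ := by
    have h1 := hgap w _ hwg hwE
    rw [add_sub_cancel_left] at h1
    have h2 := mul_le_mul_of_nonneg_right hμ (norm_nonneg w)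
    rw [div_mul_eq_mul_div, le_div_iff₀ hδ]
    linarith
  have hwgi : (inner ℂ w g).re = (μ - lam) * ‖w‖ ^ 2 + (inner ℂ w r).re := by
    rw [hgw, inner_add_right, inner_add_right, inner_smul_right _ v,
      inner_eq_zero_symm.mp (hwE v hvE), mul_zero, add_zero, Complex.add_re,
      inner_ofReal_smul_re, inner_self_re]
  refine ⟨v, hvE, hwn, ?_, ?_⟩
  · refine (sobolevNorm_one_sq_le hwg).trans ?_
    rw [inner_add_right, Complex.add_re, inner_ofReal_smul_re, inner_self_re, hwgi]
    linarith [re_inner_le w r]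
  -- The eigenvalue error is `(u, g) = (w, g)`: the kernel part `v` contributes nothing, so only
  -- terms quadratic in `w` and `r` remain.
  · have h1 : (inner ℂ u g).re = μ - lam := by
      rw [hgdef, inner_add_right, inner_eq_zero_of_mem_orthogonal hu hr, add_zero,
        inner_ofReal_smul_re, inner_self_re, hu1, one_pow, mul_one]
    have h2 : (inner ℂ u g).re = (inner ℂ w g).re := by
      conv_lhs => rw [huv, inner_add_left, hgE v hvE, add_zero]
    linarith [re_inner_le w r]

theorem sobolevDist_le {s : ℝ} {u v : L2per} {E : Submodule ℂ L2per} (hv : v ∈ E) :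
    sobolevDist s u E ≤ sobolevNorm s (u - v) :=
  ciInf_le (f := fun v : E => sobolevNorm s (u - v))
    ⟨0, by rintro _ ⟨v, rfl⟩; exact Real.sqrt_nonneg _⟩ ⟨v, hv⟩

/-- Exponential convergence of the planewave approximation, for an operator `-Δ + M` for which
the residuals of the discrete eigenvectors decay exponentially. -/
theorem exists_lowestEigenvalue_convergence (hM : M.IsSymmetric) {A : ℝ} (hA : 0 < A)
    (hdecay : ∀ Λ : ℝ, ∃ C : ℝ, 0 ≤ C ∧ ∀ N : ℝ, 0 < N → ∀ u ∈ planeWaveSpace N, ‖u‖ = 1 →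
      ∀ μ ≤ Λ, ∀ r ∈ (planeWaveSpace N)ᗮ, (u, (μ : ℂ) • u + r) ∈ graph M →
        ‖r‖ ≤ C * Real.exp (-A * N))
    {E : ℝ → Submodule ℂ L2per} (hE : ∀ ν u, u ∈ E ν ↔ (u, (ν : ℂ) • u) ∈ graph M)
    {D : ℝ → ℝ → Submodule ℂ L2per}
    (hD : ∀ N ν u, u ∈ D N ν ↔ u ∈ planeWaveSpace N ∧
      ∃ r ∈ (planeWaveSpace N)ᗮ, (u, (ν : ℂ) • u + r) ∈ graph M) (m : ℕ) :
    ∃ lam : ℝ, IsLowestEigenvalue E (m + 1) lam ∧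
      ∃ c : ℝ, 0 ≤ c ∧ ∀ N : ℝ, 0 < N → m + 1 ≤ 2 * ⌊N⌋₊ + 1 →
        ∃ lamN : ℝ, IsLowestEigenvalue (D N) (m + 1) lamN ∧
          (∀ u ∈ D N lamN, ‖u‖ = 1 → sobolevDist 1 u (E lam) ≤ c * Real.exp (-A * N)) ∧
          0 ≤ lamN - lam ∧ lamN - lam ≤ c * Real.exp (-2 * A * N) := by
  obtain ⟨U, κ, hU, hlim⟩ := exists_isRitzFamily_top hM m
  set lam := κ (Fin.last m) with hlam
  have hElow : IsLowestEigenvalue E (m + 1) lam := by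
    refine hU.isLowestEigenvalue hM fun ν u => (hE ν u).trans ⟨fun h => ?_, ?_⟩
    · exact ⟨Submodule.mem_top, 0, zero_mem _, by rwa [add_zero]⟩
    · rintro ⟨-, r, hr, h⟩
      rw [Submodule.top_orthogonal_eq_bot, Submodule.mem_bot] at hr
      rwa [hr, add_zero] at h
  have hker : E lam = graphKernel M lam := by
    ext u
    exact (hE lam u).trans mem_graphKernel.symm
  -- `(m + 1) / 2` is the least integer cutoff with `2N + 1 ≥ m + 1`, so its Ritz value `Λ` bounds
  -- those of all admissible `N`.
  obtain ⟨U₀, κ₀, hU₀⟩ := exists_isRitzFamily_planeWaveSpace hM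
    (N := (((m + 1) / 2 : ℕ) : ℝ)) (m := m) (by positivity) (by rw [Nat.floor_natCast]; omega)
  set Λ := κ₀ (Fin.last m) with hΛ
  have hΛlam : lam ≤ Λ := hU₀.le_of_le hU le_top _
  have hΛM : -‖M‖ ≤ Λ := hU₀.neg_opNorm_le _
  obtain ⟨δ, hδ, hgap⟩ := exists_gap M lam
  obtain ⟨N₁, hN₁⟩ := hlim (Fin.last m) (δ / 2) (by positivity)
  obtain ⟨C, hC, hres⟩ := hdecay Λ
  set K₁ := (1 + ‖M‖ + Λ) * (2 / δ) ^ 2 + 2 / δ with hK₁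
  set K₂ := (Λ - lam) * (2 / δ) ^ 2 + 2 / δ with hK₂
  have hMΛ : 0 ≤ 1 + ‖M‖ + Λ := by linarith
  have hΛl : 0 ≤ Λ - lam := sub_nonneg.mpr hΛlam
  have hK₁0 : 0 ≤ K₁ := by positivity
  have hK₂0 : 0 ≤ K₂ := by positivity
  -- `c₁` and `c₃` serve `N ≥ N₁`. For `N < N₁`, `c₂` and `c₄` come from the a priori bounds through
  -- `Λ`, with `e^{A N₁}` or `e^{2 A N₁}` offsetting the required decay.
  set c₁ := √K₁ * C with hc₁
  set c₂ := √(1 + ‖M‖ + Λ) * Real.exp (A * N₁) with hc₂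
  set c₃ := K₂ * C ^ 2 with hc₃
  set c₄ := (Λ - lam) * Real.exp (2 * A * N₁) with hc₄
  have hc₁0 : 0 ≤ c₁ := by positivity
  have hc₂0 : 0 ≤ c₂ := by positivity
  have hc₃0 : 0 ≤ c₃ := by positivity
  have hc₄0 : 0 ≤ c₄ := by positivity
  refine ⟨lam, hElow, c₁ + c₂ + c₃ + c₄, by positivity, fun N hN hmN => ?_⟩
  obtain ⟨u', κ', hu'⟩ := exists_isRitzFamily_planeWaveSpace hM hN.le hmN
  have hlamN : lam ≤ κ' (Fin.last m) := hu'.le_of_le hU le_top _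
  have hNΛ : κ' (Fin.last m) ≤ Λ := by
    refine hU₀.le_of_le hu' (planeWaveSpace_mono ?_) _
    rw [← Nat.le_floor_iff hN.le]
    omega
  set lamN := κ' (Fin.last m) with hlamNdef
  have hexp : Real.exp (-2 * A * N) = Real.exp (-A * N) ^ 2 := by
    rw [← Real.exp_nat_mul]
    congr 1
    push_cast
    ring
  have hnear : N₁ ≤ N → |lamN - lam| ≤ δ / 2 := fun h => by
    rw [abs_of_nonneg (sub_nonneg.mpr hlamN)]
    linarith [hN₁ N h u' κ' hu']
  refine ⟨lamN, hu'.isLowestEigenvalue hM (hD N), fun u hu hu1 => ?_, sub_nonneg.mpr hlamN, ?_⟩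
  · obtain ⟨huX, r, hr, hg⟩ := (hD N lamN u).mp hu
    rw [hker]
    have hsmall : ∀ {d : ℝ}, 0 ≤ d → d ≤ c₁ + c₂ + c₃ + c₄ →
        sobolevDist 1 u (graphKernel M lam) ≤ d * Real.exp (-A * N) →
        sobolevDist 1 u (graphKernel M lam) ≤ (c₁ + c₂ + c₃ + c₄) * Real.exp (-A * N) :=
      fun _ h h' => h'.trans (mul_le_mul_of_nonneg_right h (Real.exp_nonneg _))
    rcases le_or_gt N₁ N with hle | hlt
    · obtain ⟨v, hv, hw, hs, -⟩ := exists_mem_graphKernel_near hM hδ hgap (hnear hle) huX hu1 hr hg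
      refine hsmall hc₁0 (by linarith) ((sobolevDist_le hv).trans ?_)
      have hrn := hres N hN u huX hu1 lamN hNΛ r hr hg
      have h1 : sobolevNorm 1 (u - v) ^ 2 ≤ K₁ * ‖r‖ ^ 2 := by
        refine hs.trans ?_
        have h2 : (1 + ‖M‖ + lamN) * ‖u - v‖ ^ 2 ≤ (1 + ‖M‖ + Λ) * (2 / δ * ‖r‖) ^ 2 := by
          gcongr
        have h3 : ‖u - v‖ * ‖r‖ ≤ 2 / δ * ‖r‖ * ‖r‖ := by gcongr
        refine (add_le_add h2 h3).trans_eq ?_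
        rw [hK₁]
        ring
      have h4 : sobolevNorm 1 (u - v) ≤ √K₁ * ‖r‖ := by
        refine (sq_le_sq₀ (Real.sqrt_nonneg _) (by positivity)).mp ?_
        rwa [mul_pow, Real.sq_sqrt hK₁0]
      rw [hc₁, mul_assoc]
      exact h4.trans (by gcongr)
    · refine hsmall hc₂0 (by linarith) ((sobolevDist_le (zero_mem _)).trans ?_)
      rw [sub_zero]
      have h1 := sobolevNorm_one_sq_le hg
      rw [inner_add_right, inner_eq_zero_of_mem_orthogonal huX hr, add_zero,
        inner_ofReal_smul_re, inner_self_re, hu1, one_pow, mul_one, mul_one] at h1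
      have h2 : sobolevNorm 1 u ≤ √(1 + ‖M‖ + Λ) :=
        Real.le_sqrt_of_sq_le (h1.trans (by linarith))
      rw [hc₂, mul_assoc, ← Real.exp_add]
      refine h2.trans (le_mul_of_one_le_right (Real.sqrt_nonneg _) (Real.one_le_exp ?_))
      linarith [mul_le_mul_of_nonneg_left hlt.le hA.le]
  · have hsmall : ∀ {d : ℝ}, d ≤ c₁ + c₂ + c₃ + c₄ → lamN - lam ≤ d * Real.exp (-2 * A * N) →
        lamN - lam ≤ (c₁ + c₂ + c₃ + c₄) * Real.exp (-2 * A * N) :=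
      fun h h' => h'.trans (mul_le_mul_of_nonneg_right h (Real.exp_nonneg _))
    rcases le_or_gt N₁ N with hle | hlt
    · obtain ⟨r, hr, hg⟩ := hu'.eig (Fin.last m)
      obtain ⟨v, hv, hw, -, hs⟩ := exists_mem_graphKernel_near hM hδ hgap (hnear hle)
        (hu'.mem _) (hu'.orth.1 _) hr hg
      have hrn := hres N hN _ (hu'.mem _) (hu'.orth.1 _) lamN hNΛ r hr hg
      refine hsmall (by linarith : c₃ ≤ _) (hs.trans ?_)
      have h2 : (lamN - lam) * ‖u' (Fin.last m) - v‖ ^ 2 ≤ (Λ - lam) * (2 / δ * ‖r‖) ^ 2 := by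
        gcongr
      have h3 : ‖u' (Fin.last m) - v‖ * ‖r‖ ≤ 2 / δ * ‖r‖ * ‖r‖ := by gcongr
      have h4 : K₂ * ‖r‖ ^ 2 ≤ K₂ * (C * Real.exp (-A * N)) ^ 2 := by gcongr
      rw [hexp, hc₃, mul_assoc, ← mul_pow]
      refine le_trans ?_ h4
      refine (add_le_add h2 h3).trans_eq ?_
      rw [hK₂]
      ring
    · refine hsmall (by linarith : c₄ ≤ _) ?_
      rw [hc₄, mul_assoc, ← Real.exp_add]
      refine (sub_le_sub_right hNΛ lam).trans
        (le_mul_of_one_le_right hΛl (Real.one_le_exp ?_))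
      linarith [mul_le_mul_of_nonneg_left hlt.le hA.le]

/-! ### Exponential decay of the discrete eigenvectors -/

theorem summable_exp_neg_mul_abs {c : ℝ} (hc : 0 < c) :
    Summable fun k : ℤ => Real.exp (-c * |(k : ℝ)|) := by
  have h : Summable fun n : ℕ => Real.exp (-c * |((n : ℤ) : ℝ)|) := by
    refine (summable_geometric_of_lt_one (Real.exp_nonneg (-c))
      (Real.exp_lt_one_iff.mpr (neg_lt_zero.mpr hc))).congr fun n => ?_
    rw [← Real.exp_nat_mul, Int.cast_natCast, Nat.abs_cast, mul_comm]
  refine Summable.of_nat_of_neg h (h.congr fun n => ?_)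
  simp

/-- Weighted `ℓ²` passes to weighted `ℓ¹` at any smaller rate, because `e^{-(B-A)|k|}` is square
summable. -/
theorem summable_exp_mul_norm_coeff {A B : ℝ} (hAB : A < B) {V : L2per}
    (hV : V ∈ analyticSpace B) : Summable fun k : ℤ => Real.exp (A * |(k : ℝ)|) * ‖coeff V k‖ := by
  have hV' : Summable fun k : ℤ => Real.cosh (2 * B * k) * ‖coeff V k‖ ^ 2 := hV
  refine Summable.of_nonneg_of_le (fun k => by positivity) (fun k => ?_)
    ((summable_exp_neg_mul_abs (show 0 < 2 * (B - A) by linarith)).add (hV'.mul_left 2))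
  have h1 : Real.exp (2 * B * |(k : ℝ)|) ≤ 2 * Real.cosh (2 * B * k) := by
    rw [Real.cosh_eq]
    rcases abs_cases (k : ℝ) with ⟨h, -⟩ | ⟨h, -⟩ <;> rw [h]
    · linarith [Real.exp_pos (-(2 * B * k))]
    · rw [mul_neg]
      linarith [Real.exp_pos (2 * B * k)]
  set x := Real.exp (-(B - A) * |(k : ℝ)|) with hx
  set y := Real.exp (B * |(k : ℝ)|) with hy
  have h2 : Real.exp (A * |(k : ℝ)|) = x * y := by
    rw [hx, hy, ← Real.exp_add]
    ring_nf
  have h3 : Real.exp (-(2 * (B - A)) * |(k : ℝ)|) = x ^ 2 := by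
    rw [hx, ← Real.exp_nat_mul]
    push_cast
    ring_nf
  have h4 : Real.exp (2 * B * |(k : ℝ)|) = y ^ 2 := by
    rw [hy, ← Real.exp_nat_mul]
    push_cast
    ring_nf
  rw [h2, h3]
  rw [h4] at h1
  have h5 := mul_le_mul_of_nonneg_right h1 (sq_nonneg ‖coeff V k‖)
  nlinarith [sq_nonneg (x - y * ‖coeff V k‖), sq_nonneg x, sq_nonneg (y * ‖coeff V k‖)]

/-- `M` acts as convolution with `a`, and the weight is submultiplicative: `e^{A|k|} ≤ e^{A|k-l|}
e^{A|l|}`. This is Young's inequality `ℓ¹ * ℓ^∞ → ℓ^∞` with weights. -/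
theorem exp_mul_norm_coeff_apply_le {a : ℤ → ℂ} {A : ℝ} (hA : 0 ≤ A)
    (ha : Summable fun k : ℤ => Real.exp (A * |(k : ℝ)|) * ‖a k‖)
    (hMa : ∀ k l, coeff (M (planeWave l)) k = a (k - l)) {N S : ℝ} {u : L2per}
    (hu : u ∈ planeWaveSpace N) (hS : ∀ l : ℤ, Real.exp (A * |(l : ℝ)|) * ‖coeff u l‖ ≤ S) (k : ℤ) :
    Real.exp (A * |(k : ℝ)|) * ‖coeff (M u) k‖
      ≤ (∑' k : ℤ, Real.exp (A * |(k : ℝ)|) * ‖a k‖) * S := by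
  have hS0 : 0 ≤ S := le_trans (by positivity) (hS 0)
  have h1 : coeff (M u) k = ∑ l ∈ frequencies N, coeff u l * a (k - l) := by
    conv_lhs => rw [← truncation_eq_self hu, truncation_apply]
    simp only [map_sum, map_smul, coeff_sum, coeff_smul, hMa]
  rw [h1]
  have h2 : ∀ l ∈ frequencies N, Real.exp (A * |(k : ℝ)|) * ‖coeff u l * a (k - l)‖
      ≤ Real.exp (A * |((k - l : ℤ) : ℝ)|) * ‖a (k - l)‖ * S := fun l _ => by
    have h3 : Real.exp (A * |(k : ℝ)|)
        ≤ Real.exp (A * |((k - l : ℤ) : ℝ)|) * Real.exp (A * |(l : ℝ)|) := by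
      rw [← Real.exp_add, Real.exp_le_exp, ← mul_add]
      refine mul_le_mul_of_nonneg_left ?_ hA
      push_cast
      simpa using abs_add_le ((k : ℝ) - l) l
    rw [norm_mul]
    calc Real.exp (A * |(k : ℝ)|) * (‖coeff u l‖ * ‖a (k - l)‖)
        ≤ Real.exp (A * |((k - l : ℤ) : ℝ)|) * Real.exp (A * |(l : ℝ)|)
          * (‖coeff u l‖ * ‖a (k - l)‖) := by gcongr
      _ = Real.exp (A * |((k - l : ℤ) : ℝ)|) * ‖a (k - l)‖
          * (Real.exp (A * |(l : ℝ)|) * ‖coeff u l‖) := by ring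
      _ ≤ _ := by gcongr; exact hS l
  calc Real.exp (A * |(k : ℝ)|) * ‖∑ l ∈ frequencies N, coeff u l * a (k - l)‖
      ≤ Real.exp (A * |(k : ℝ)|) * ∑ l ∈ frequencies N, ‖coeff u l * a (k - l)‖ := by
        gcongr
        exact norm_sum_le _ _
    _ ≤ ∑ l ∈ frequencies N, Real.exp (A * |((k - l : ℤ) : ℝ)|) * ‖a (k - l)‖ * S := by
        rw [Finset.mul_sum]
        exact Finset.sum_le_sum h2
    _ ≤ _ := by
        rw [← Finset.sum_mul]
        refine mul_le_mul_of_nonneg_right ?_ hS0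
        rw [← (Equiv.subLeft k).tsum_eq fun k : ℤ => Real.exp (A * |(k : ℝ)|) * ‖a k‖]
        exact ((Equiv.subLeft k).summable_iff.mpr ha).sum_le_tsum _
          fun l _ => mul_nonneg (Real.exp_nonneg _) (norm_nonneg _)

/-- At a frequency `p` where `e^{A|l|} |û_l|` attains its maximum `b`, the equation gives `|μ - p²|
b ≤ g b`. Either `|p| ≤ K`, and `b ≤ e^{AK}` because `‖u‖ = 1`, or `p² - μ ≥ g + 1` and `b = 0`. No
bound depends on `N`. -/
theorem exists_exp_decay_eigenvector {a : ℤ → ℂ} {A : ℝ} (hA : 0 ≤ A)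
    (ha : Summable fun k : ℤ => Real.exp (A * |(k : ℝ)|) * ‖a k‖)
    (hMa : ∀ k l, coeff (M (planeWave l)) k = a (k - l)) (Λ : ℝ) :
    ∃ S : ℝ, ∀ N : ℝ, 0 < N → ∀ u ∈ planeWaveSpace N, ‖u‖ = 1 →
      ∀ μ ≤ Λ, ∀ r ∈ (planeWaveSpace N)ᗮ, (u, (μ : ℂ) • u + r) ∈ graph M →
        ∀ l : ℤ, Real.exp (A * |(l : ℝ)|) * ‖coeff u l‖ ≤ S := by
  set g := ∑' k : ℤ, Real.exp (A * |(k : ℝ)|) * ‖a k‖ with hg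
  have hg0 : 0 ≤ g := tsum_nonneg fun k => by positivity
  set K := |Λ| + g + 1 with hK
  have hK1 : 1 ≤ K := by linarith [abs_nonneg Λ]
  refine ⟨Real.exp (A * K), fun N hN u hu hu1 μ hμ r hr hgr l => ?_⟩
  obtain ⟨p, hp, hmax⟩ := (frequencies N).exists_max_image
    (fun l : ℤ => Real.exp (A * |(l : ℝ)|) * ‖coeff u l‖)
    ⟨0, mem_frequencies.mpr (by simpa using hN.le)⟩
  set b := Real.exp (A * |(p : ℝ)|) * ‖coeff u p‖ with hb
  have hb0 : 0 ≤ b := by positivity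
  have hle : ∀ l : ℤ, Real.exp (A * |(l : ℝ)|) * ‖coeff u l‖ ≤ b := fun l => by
    by_cases hl : l ∈ frequencies N
    · exact hmax l hl
    · rw [mem_planeWaveSpace.mp hu l hl, norm_zero, mul_zero]
      exact hb0
  refine (hle l).trans ?_
  rcases le_or_gt |(p : ℝ)| K with hpK | hpK
  · have h1 := norm_coeff_le u p
    rw [hu1] at h1
    calc b ≤ Real.exp (A * K) * 1 := by rw [hb]; gcongr
      _ = _ := mul_one _
  · have h1 := exp_mul_norm_coeff_apply_le hA ha hMa hu hle p
    have h2 := coeff_eigenvector hr hgr hp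
    have h3 : coeff (M u) p = ((μ - (p : ℝ) ^ 2 : ℝ) : ℂ) * coeff u p := by
      push_cast
      linear_combination -h2
    rw [h3, norm_mul, Complex.norm_real, Real.norm_eq_abs, mul_left_comm, ← hb, ← hg] at h1
    -- The summand `1` in `K` gives `K ≥ 1`, so that `|p| > K` implies `p² > K`.
    have h4 : K < (p : ℝ) ^ 2 := by
      rw [← sq_abs]
      nlinarith
    have h5 : g + 1 ≤ |μ - (p : ℝ) ^ 2| := by
      rw [abs_sub_comm]
      linarith [le_abs_self ((p : ℝ) ^ 2 - μ), le_abs_self Λ]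
    have h6 : b ≤ 0 := by nlinarith
    exact h6.trans (Real.exp_nonneg _)

/-- The residual lives on `|k| > N`, with coefficients at most `g S e^{-A'|k|}`. The factor
`e^{-A|k|}` gives the rate `e^{-AN}`, and `e^{-(A'-A)|k|}` makes the squares summable. -/
theorem exists_exp_decay_residual {a : ℤ → ℂ} {A A' : ℝ} (hA : 0 ≤ A) (hAA' : A < A')
    (ha : Summable fun k : ℤ => Real.exp (A' * |(k : ℝ)|) * ‖a k‖)
    (hMa : ∀ k l, coeff (M (planeWave l)) k = a (k - l)) (Λ : ℝ) :
    ∃ C : ℝ, 0 ≤ C ∧ ∀ N : ℝ, 0 < N → ∀ u ∈ planeWaveSpace N, ‖u‖ = 1 →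
      ∀ μ ≤ Λ, ∀ r ∈ (planeWaveSpace N)ᗮ, (u, (μ : ℂ) • u + r) ∈ graph M →
        ‖r‖ ≤ C * Real.exp (-A * N) := by
  obtain ⟨S, hS⟩ := exists_exp_decay_eigenvector (hA.trans hAA'.le) ha hMa Λ
  set g := ∑' k : ℤ, Real.exp (A' * |(k : ℝ)|) * ‖a k‖ with hg
  set T := ∑' k : ℤ, Real.exp (-(2 * (A' - A)) * |(k : ℝ)|) with hT
  have hTs := summable_exp_neg_mul_abs (show 0 < 2 * (A' - A) by linarith)
  have hT0 : 0 ≤ T := tsum_nonneg fun k => by positivity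
  refine ⟨√T * |g * S|, by positivity, fun N hN u hu hu1 μ hμ r hr hgr => ?_⟩
  refine (sq_le_sq₀ (norm_nonneg _) (by positivity)).mp ?_
  rw [mul_pow, mul_pow, Real.sq_sqrt hT0, sq_abs]
  have h1 := (hTs.hasSum.mul_right ((g * S) ^ 2 * Real.exp (-A * N) ^ 2))
  rw [← hT, ← mul_assoc] at h1
  refine hasSum_le (fun k => ?_) (hasSum_norm_coeff_sq r) h1
  rw [coeff_residual hu hr hgr]
  split_ifs with hk
  · rw [norm_zero]
    exact (show (0 : ℝ) ^ 2 = 0 by norm_num).trans_le (by positivity)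
  · have h2 := exp_mul_norm_coeff_apply_le (hA.trans hAA'.le) ha hMa hu
      (hS N hN u hu hu1 μ hμ r hr hgr) k
    rw [mem_frequencies, not_le] at hk
    have h3 : ‖coeff (M u) k‖
        ≤ g * S * (Real.exp (-(A' - A) * |(k : ℝ)|) * Real.exp (-A * |(k : ℝ)|)) := by
      rw [← Real.exp_add, ← add_mul, show -(A' - A) + -A = -A' by ring, neg_mul, Real.exp_neg,
        ← div_eq_mul_inv, le_div_iff₀ (Real.exp_pos _), mul_comm]
      exact h2
    have h4 : Real.exp (-A * |(k : ℝ)|) ≤ Real.exp (-A * N) := by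
      rw [Real.exp_le_exp]
      nlinarith
    have hgS : 0 ≤ g * S := le_trans (by positivity) h2
    have h5 : Real.exp (-(2 * (A' - A)) * |(k : ℝ)|) = Real.exp (-(A' - A) * |(k : ℝ)|) ^ 2 := by
      rw [← Real.exp_nat_mul]
      push_cast
      ring_nf
    calc ‖coeff (M u) k‖ ^ 2
        ≤ (g * S * (Real.exp (-(A' - A) * |(k : ℝ)|) * Real.exp (-A * N))) ^ 2 := by
          gcongr
          exact h3.trans (by gcongr)
      _ = _ := by rw [h5]; ring

/-! ### Multiplication by a continuous function -/

theorem memLp_continuous_mul (F : C(Circle2Pi, ℂ)) (u : L2per) :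
    MemLp (fun x => F x * u x) 2 (volume : Measure Circle2Pi) :=
  (((Lp.memLp u).norm.const_mul ‖F‖).mono (F.continuous.aestronglyMeasurable.mul (Lp.memLp u).1)
    (Eventually.of_forall fun x => by
      simp only [norm_mul, norm_norm]
      exact mul_le_mul_of_nonneg_right (F.norm_coe_le_norm x) (norm_nonneg _)))

/-- Multiplication by a continuous function, as a bounded operator on `L²_per`. -/
noncomputable def mulOp (F : C(Circle2Pi, ℂ)) : L2per →L[ℂ] L2per :=
  LinearMap.mkContinuous
    { toFun := fun u => (memLp_continuous_mul F u).toLp _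
      map_add' := fun u v => by
        rw [← MemLp.toLp_add]
        refine MemLp.toLp_congr _ _ ?_
        filter_upwards [Lp.coeFn_add u v] with x hx
        simp only [Pi.add_apply, hx, mul_add]
      map_smul' := fun c u => by
        rw [RingHom.id_apply, ← MemLp.toLp_const_smul]
        refine MemLp.toLp_congr _ _ ?_
        filter_upwards [Lp.coeFn_smul c u] with x hx
        simp only [Pi.smul_apply, hx, smul_eq_mul, mul_left_comm] }
    ‖F‖ fun u => by
      refine Lp.norm_le_mul_norm_of_ae_le_mul ?_
      filter_upwards [(memLp_continuous_mul F u).coeFn_toLp] with x hx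
      simp only [LinearMap.coe_mk, AddHom.coe_mk]
      rw [hx, norm_mul]
      exact mul_le_mul_of_nonneg_right (F.norm_coe_le_norm x) (norm_nonneg _)

theorem coeFn_mulOp (F : C(Circle2Pi, ℂ)) (u : L2per) :
    mulOp F u =ᵐ[volume] fun x => F x * u x := (memLp_continuous_mul F u).coeFn_toLp

theorem mulPotential_eq_mulOp {V : L2per} {F : C(Circle2Pi, ℂ)} (hF : V =ᵐ[volume] F)
    (u : sobolev 1) : mulPotential V u = mulOp F u := by
  refine MemLp.toLp_congr (memLp_mul V u u.2) (memLp_continuous_mul F u) ?_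
  filter_upwards [hF] with x hx
  rw [hx]

theorem mulOp_isSymmetric {F : C(Circle2Pi, ℂ)} (hF : ∀ᵐ x, (F x).im = 0) :
    (mulOp F).IsSymmetric := by
  intro u v
  change inner ℂ (mulOp F u) v = inner ℂ u (mulOp F v)
  rw [L2.inner_def, L2.inner_def]
  refine integral_congr_ae ?_
  filter_upwards [coeFn_mulOp F u, coeFn_mulOp F v, hF] with x hu hv hx
  rw [hu, hv, RCLike.inner_apply', RCLike.inner_apply', map_mul, Complex.conj_eq_iff_im.mpr hx]
  ring

theorem coeFn_planeWave (k : ℤ) :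
    planeWave k =ᵐ[volume] fun x => (((√(2 * π))⁻¹ : ℝ) : ℂ) * fourier k x := by
  filter_upwards [Lp.coeFn_smul (((√(2 * π))⁻¹ : ℝ) : ℂ)
    (ContinuousMap.toLp (E := ℂ) 2 (volume : Measure Circle2Pi) ℂ (fourier k)),
    ContinuousMap.coeFn_toLp (E := ℂ) (p := 2) (volume : Measure Circle2Pi) (𝕜 := ℂ)
      (fourier k)] with x h1 h2
  rw [planeWave, h1, Pi.smul_apply, h2, smul_eq_mul]

theorem coeff_mulOp_planeWave {V : L2per} {F : C(Circle2Pi, ℂ)} (hF : V =ᵐ[volume] F)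
    (k l : ℤ) : coeff (mulOp F (planeWave l)) k
      = (((√(2 * π))⁻¹ : ℝ) : ℂ) * coeff V (k - l) := by
  rw [coeff, coeff, L2.inner_def, L2.inner_def, ← integral_const_mul]
  refine integral_congr_ae ?_
  filter_upwards [coeFn_mulOp F (planeWave l), coeFn_planeWave k, coeFn_planeWave l,
    coeFn_planeWave (k - l), hF] with x h1 h2 h3 h4 h5
  rw [RCLike.inner_apply', RCLike.inner_apply', h1, h2, h3, h4, h5, sub_eq_add_neg, fourier_add,
    fourier_neg]
  simp only [map_mul, Complex.conj_ofReal, Complex.conj_conj]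
  ring

/-! ### The eigenvalue problems in terms of the graph -/

/-- Elliptic regularity, from `(1 + k²)² ≤ 2 (1 + k⁴)`. -/
theorem mem_sobolev_two_of_mem_graph {u f : L2per} (hu : (u, f) ∈ graph M) : u ∈ sobolev 2 := by
  rw [mem_sobolev_two]
  refine Summable.of_nonneg_of_le (fun k => by positivity) (fun k => ?_)
    (((hasSum_norm_coeff_sq u).summable.add
      (hasSum_norm_coeff_sq (f - M u)).summable).mul_left 2)
  rw [coeff_sub, mem_graph.mp hu k, add_sub_cancel_right, norm_mul, norm_pow,
    Complex.norm_intCast, sq_abs]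
  nlinarith [sq_nonneg ((1 - (k : ℝ) ^ 2) * ‖coeff u k‖)]

theorem mem_eigenspace_schrodinger_iff {V : L2per} {F : C(Circle2Pi, ℂ)} (hF : V =ᵐ[volume] F)
    (ν : ℝ) (u : L2per) :
    u ∈ eigenspace (schrodinger V) ν ↔ (u, (ν : ℂ) • u) ∈ graph (mulOp F) := by
  have hT : ∀ h : u ∈ sobolev 2, ∀ k, coeff (schrodinger V ⟨u, h⟩) k
      = (k : ℂ) ^ 2 * coeff u k + coeff (mulOp F u) k := fun h k => by
    have h1 : schrodinger V ⟨u, h⟩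
        = mulPotential V ⟨u, sobolev_two_le_one h⟩ - laplacian ⟨u, h⟩ := neg_add_eq_sub _ _
    rw [h1, coeff_sub, mulPotential_eq_mulOp hF, laplacian, coeff_fourierMultiplier]
    ring
  rw [mem_eigenspace]
  constructor
  · rintro ⟨h, he⟩ k
    dsimp only
    rw [← he, hT h]
  · intro h
    have hs := mem_sobolev_two_of_mem_graph h
    exact ⟨hs, ext_coeff fun k => (hT hs k).trans (mem_graph.mp h k).symm⟩

/-- Testing on `e_k` reads off one coefficient of `-Δu + Vu`, conjugated because `u` sits in the
conjugate-linear slot. -/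
theorem energyForm_planeWave {V : L2per} {F : C(Circle2Pi, ℂ)} (hF : V =ᵐ[volume] F)
    (hM : (mulOp F).IsSymmetric) (u : sobolev 1) (k : ℤ) :
    energyForm V u ⟨planeWave k, planeWave_mem_sobolev 1 k⟩
      = conj ((k : ℂ) ^ 2 * coeff u k + coeff (mulOp F u) k) := by
  have h1 : grad ⟨planeWave k, planeWave_mem_sobolev 1 k⟩ = (Complex.I * k) • planeWave k :=
    ext_coeff fun l => by
      rw [grad, coeff_fourierMultiplier, coeff_smul, coeff_planeWave]
      split_ifs with h
      · rw [h]
      · rw [mul_zero, mul_zero]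
  have h2 : inner ℂ (u : L2per) (mulOp F (planeWave k)) = conj (coeff (mulOp F u) k) := by
    rw [coeff, inner_conj_symm]
    exact (hM u (planeWave k)).symm
  have h3 : inner ℂ (grad u) (planeWave k) = conj (Complex.I * k * coeff u k) := by
    rw [← inner_conj_symm]
    congr 1
    exact coeff_fourierMultiplier _ _ _ u k
  rw [energyForm_eq, h1, mulPotential_eq_mulOp hF, h2, inner_smul_right, h3]
  simp only [map_mul, map_add, map_pow, map_intCast, Complex.conj_I]
  linear_combination (-(k : ℂ) ^ 2 * conj (coeff u k)) * Complex.I_sq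

theorem mem_discreteEigenspace_iff {V : L2per} {F : C(Circle2Pi, ℂ)} (hF : V =ᵐ[volume] F)
    (hM : (mulOp F).IsSymmetric) (N ν : ℝ) (u : L2per) :
    u ∈ discreteEigenspace V N ν ↔ u ∈ planeWaveSpace N ∧
      ∃ r ∈ (planeWaveSpace N)ᗮ, (u, (ν : ℂ) • u + r) ∈ graph (mulOp F) := by
  have hint : ∀ v : L2per, ∫ x, conj (u x) * v x = inner ℂ u v := fun v => by
    rw [L2.inner_def]
    simp only [RCLike.inner_apply']
  have hinner : ∀ k, inner ℂ u (planeWave k) = conj (coeff u k) := fun k =>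
    (inner_conj_symm _ _).symm
  constructor
  · rintro ⟨hu, h⟩
    refine ⟨hu, ?_⟩
    obtain ⟨f, hf⟩ := exists_mem_graph (M := mulOp F) hu
    refine ⟨f - (ν : ℂ) • u, ?_, by rwa [add_sub_cancel]⟩
    rw [mem_planeWaveSpace_orthogonal]
    intro k hk
    have h1 := h _ (planeWave_mem_planeWaveSpace hk)
    rw [energyForm_planeWave hF hM, hint, hinner, ← Complex.conj_ofReal ν, ← map_mul] at h1
    rw [coeff_sub, coeff_smul, mem_graph.mp hf k, sub_eq_zero]
    exact (starRingEnd ℂ).injective h1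
  · rintro ⟨hu, r, hr, hg⟩
    refine ⟨hu, fun v hv => ?_⟩
    rw [hint]
    set u₁ : sobolev 1 := ⟨u, planeWaveSpace_le_sobolev N 1 hu⟩
    have hlin : ∀ (w : L2per) (hw : w ∈ planeWaveSpace N),
        energyForm V u₁ ⟨w, planeWaveSpace_le_sobolev N 1 hw⟩ = ν * inner ℂ u w := by
      intro w hw
      -- Membership in `H¹` is part of the claim so that the induction over the span can carry it.
      have key : ∀ w ∈ Submodule.span ℂ (planeWave '' (frequencies N : Set ℤ)),
          ∃ h : w ∈ sobolev 1, energyForm V u₁ ⟨w, h⟩ = ν * inner ℂ u w := by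
        intro w hw
        induction hw using Submodule.span_induction with
        | mem x hx =>
          obtain ⟨k, hk, rfl⟩ := hx
          refine ⟨planeWave_mem_sobolev 1 k, ?_⟩
          rw [energyForm_planeWave hF hM, hinner, ← coeff_eigenvector hr hg hk, map_mul,
            Complex.conj_ofReal]
        | zero =>
          refine ⟨zero_mem _, ?_⟩
          have h0 : (⟨0, zero_mem _⟩ : sobolev 1) = 0 := rfl
          rw [energyForm_eq, h0, map_zero, map_zero, inner_zero_right, inner_zero_right,
            add_zero, mul_zero]
        | add x y _ _ hx hy =>
          obtain ⟨hx, ex⟩ := hx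
          obtain ⟨hy, ey⟩ := hy
          refine ⟨add_mem hx hy, ?_⟩
          have h0 : (⟨x + y, add_mem hx hy⟩ : sobolev 1) = ⟨x, hx⟩ + ⟨y, hy⟩ := rfl
          rw [energyForm_eq] at ex ey ⊢
          rw [h0, map_add, map_add, inner_add_right, inner_add_right, inner_add_right, mul_add,
            ← ex, ← ey]
          ring
        | smul c x _ hx =>
          obtain ⟨hx, ex⟩ := hx
          refine ⟨Submodule.smul_mem _ c hx, ?_⟩
          have h0 : (⟨c • x, Submodule.smul_mem _ c hx⟩ : sobolev 1) = c • ⟨x, hx⟩ := rfl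
          rw [energyForm_eq] at ex ⊢
          rw [h0, map_smul, map_smul, inner_smul_right, inner_smul_right, inner_smul_right,
            mul_left_comm, ← ex]
          ring
      rw [planeWaveSpace_eq_span] at hw
      exact (key w hw).2
    exact hlin v hv

theorem analyticSpace_le_sobolev_one {B : ℝ} (hB : 0 < B) : analyticSpace B ≤ sobolev 1 := by
  intro V hV
  have hV' : Summable fun k : ℤ => Real.cosh (2 * B * k) * ‖coeff V k‖ ^ 2 := hV
  rw [mem_sobolev_one]
  refine Summable.of_nonneg_of_le (fun k => by positivity) (fun k => ?_)
    (hV'.mul_left (1 + (B ^ 2)⁻¹))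
  rw [← mul_assoc]
  refine mul_le_mul_of_nonneg_right ?_ (by positivity)
  -- With `x = 2Bk`, `x²/2 ≤ e^{|x|} ≤ 2 cosh x`, hence `k² ≤ B⁻² cosh (2Bk)`.
  have h1 := Real.quadratic_le_exp_of_nonneg (abs_nonneg (2 * B * k))
  have h2 := Real.exp_abs_le (2 * B * k)
  rw [sq_abs] at h1
  have h3 : (k : ℝ) ^ 2 = (B ^ 2)⁻¹ * ((2 * B * k) ^ 2 / 4) := by
    field_simp
    ring
  have h4 : (B ^ 2)⁻¹ * ((2 * B * k) ^ 2 / 4) ≤ (B ^ 2)⁻¹ * Real.cosh (2 * B * k) := by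
    gcongr
    rw [Real.cosh_eq]
    linarith [abs_nonneg (2 * B * k)]
  rw [add_mul, one_mul, h3]
  linarith [Real.one_le_cosh (2 * B * k)]

end Planewave

theorem mainTheorem3 (B : ℝ) (hB : 0 < B) (V : Planewave.L2per)
    (hV : V ∈ Planewave.analyticSpace B) (hreal : ∀ᵐ x, (V x).im = 0)
    (j : ℕ) (hj : 1 ≤ j) (A : ℝ) (hA : 0 < A) (hAB : A < B) :
    ∃ lam : ℝ,
      Planewave.IsLowestEigenvalue (Planewave.eigenspace (Planewave.schrodinger V)) j lam ∧
      ∃ c : ℝ, 0 ≤ c ∧ ∀ N : ℝ, 0 < N → j ≤ 2 * ⌊N⌋₊ + 1 →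
        ∃ lamN : ℝ,
          Planewave.IsLowestEigenvalue (Planewave.discreteEigenspace V N) j lamN ∧
          (∀ u ∈ Planewave.discreteEigenspace V N lamN, ‖u‖ = 1 →
            Planewave.sobolevDist 1 u (Planewave.eigenspace (Planewave.schrodinger V) lam)
              ≤ c * Real.exp (-A * N)) ∧
          0 ≤ lamN - lam ∧ lamN - lam ≤ c * Real.exp (-2 * A * N) := by
  obtain ⟨m, rfl⟩ := Nat.exists_eq_add_of_le' hj
  obtain ⟨F, hF⟩ := Planewave.exists_continuous V (Planewave.analyticSpace_le_sobolev_one hB hV)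
  have hM : (Planewave.mulOp F).IsSymmetric := Planewave.mulOp_isSymmetric (by
    filter_upwards [hreal, hF] with x hx hFx
    rwa [← hFx])
  -- The intermediate rate leaves room for two losses: from `B` to `A'` in making `V` summable, from
  -- `A'` to `A` in summing the residual.
  obtain ⟨A', hAA', hA'B⟩ := exists_between hAB
  have ha : Summable fun k : ℤ => Real.exp (A' * |(k : ℝ)|)
      * ‖(((√(2 * π))⁻¹ : ℝ) : ℂ) * Planewave.coeff V k‖ := by
    refine ((Planewave.summable_exp_mul_norm_coeff hA'B hV).mul_left
      ‖(((√(2 * π))⁻¹ : ℝ) : ℂ)‖).congr fun k => ?_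
    rw [norm_mul, mul_left_comm]
  exact Planewave.exists_lowestEigenvalue_convergence hM hA
    (Planewave.exists_exp_decay_residual hA.le hAA' ha (Planewave.coeff_mulOp_planeWave hF))
    (Planewave.mem_eigenspace_schrodinger_iff hF)
    (Planewave.mem_discreteEigenspace_iff hF hM) m
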